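/- Let $\tau>0$, let $\mu$ be a finite signed Borel measure on $[-\tau,0]$, and write $\mathbb{R}_+=[0,\infty)$. For $f\in L^1_{loc}(\mathbb{R}_+;\mathbb{R})$ and $\psi\in C([-\tau,0];\mathbb{R})$ let $x=x(\cdot,\psi)$ be the solution of the delay equation $$x'(t)=\int_{[-\tau,0]}x(t+u)\,\mu(du)+f(t)\quad\text{for a.e. } t>0,\qquad x(t)=\psi(t)\ \text{ for } t\in[-\tau,0],$$ where $x$ is required to be absolutely continuous on $[0,T]$ for every $T>0$. Let $r_\tau$ be the resolvent, that is, the function that is absolutely continuous on $[0,T]$ for every $T>0$ and satisfies $r_\tau'(t)=\int_{[-\tau,0]}r_\tau(t+u)\,\mu(du)$ for a.e. $t>0$, $r_\tau(0)=1$ and $r_\tau(t)=0$ for $t<0$. Let $Ces=Ces(\mathbb{R}_+;\mathbb{R})$ be the set of all $g\in L^1_{loc}(\mathbb{R}_+;\mathbb{R})$ such that $\frac1t\int_0^t g(s)\,ds$ converges to a finite limit (the Cesàro limit of $g$) as $t\to\infty$. **(A)** Suppose $r_\tau\in L^1(\mathbb{R}_+;\mathbb{R})$. Then $\mu([-\tau,0])\neq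 0$, and for all $\psi\in C([-\tau,0];\mathbb{R})$ and $f\in L^1_{loc}(\mathbb{R}_+;\mathbb{R})$ the following hold. (i) The function $t\mapsto\int_t^{t+\theta}f(s)\,ds$ belongs to $Ces$ for all $\theta\in(0,1]$ if and only if $x(\cdot,\psi)\in Ces$. In this case there is $L\in\mathbb{R}$ such that, as $t\to\infty$, $$\frac1t\int_0^t\int_s^{s+\theta}f(u)\,du\,ds\to L\theta\ \text{ for all }\theta\in(0,1],\qquad \frac1t\int_0^t x(s,\psi)\,ds\to\frac{-L}{\mu([-\tau,0])}.$$ (ii) $f\in Ces$ if and only if $x(\cdot,\psi)\in Ces$ and $x'(\cdot,\psi)\in Ces$. In this case there is $L\in\mathbb{R}$ such that, as $t\to\infty$, $$\frac1t\int_0^t f(s)\,ds\to L,\qquad \frac1t\int_0^t x(s,\psi)\,ds\to\frac{-L}{\mu([-\tau,0])},\qquad \frac1t\int_0^t x'(s,\psi)\,ds\to 0.$$ **(B)** The following are equivalent: (i) $r_\tau\in L^1(\mathbb{R}_+;\mathbb{R})$. (ii) For all $\psi\in C([-\tau,0];\mathbb{R})$ and all $f\in Ces$, $x(\cdot,\psi)\in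 Ces$. (iii) For all $\psi\in C([-\tau,0];\mathbb{R})$ and all $f\in L^1_{loc}(\mathbb{R}_+;\mathbb{R})$ such that $t\mapsto\int_t^{t+\theta}f(s)\,ds$ belongs to $Ces$ for all $\theta\in(0,1]$, $x(\cdot,\psi)\in Ces$. -/

import Mathlib

open MeasureTheory Set Filter Topology
open scoped MeasureTheory.VectorMeasure

noncomputable section

namespace DelayCesaro

/-- `g` has Cesàro limit `L`: `(1/t) ∫₀ᵗ g(s) ds → L` as `t → ∞`. -/
def HasCesaroLimit (g : ℝ → ℝ) (L : ℝ) : Prop :=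
  Tendsto (fun t : ℝ => (1 / t) * ∫ s in (0 : ℝ)..t, g s) atTop (𝓝 L)

/-- The space `L¹_loc(ℝ₊; ℝ)`; only the values on `[0, ∞)` matter. -/
def L1loc : Set (ℝ → ℝ) := {g | LocallyIntegrableOn g (Ici 0)}

/-- The space `Ces(ℝ₊; ℝ)` of locally integrable functions with a (finite) Cesàro limit. -/
def Ces : Set (ℝ → ℝ) := {g | g ∈ L1loc ∧ ∃ L : ℝ, HasCesaroLimit g L}

/-- The interval average `t ↦ ∫_t^{t+θ} f(s) ds`. -/
def intervalAvg (f : ℝ → ℝ) (θ : ℝ) : ℝ → ℝ := fun t => ∫ s in t..(t + θ), f s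

/-- `x` is absolutely continuous on every `[0, T]` and satisfies
`x'(t) = ∫_{[-τ,0]} x(t+u) μ(du) + f(t)` for almost every `t > 0`. -/
def SolvesDelayEq {τ : ℝ} (μ : SignedMeasure (Icc (-τ) 0)) (f x : ℝ → ℝ) : Prop :=
  (∀ T : ℝ, 0 < T → AbsolutelyContinuousOnInterval x 0 T) ∧
  ∀ᵐ t : ℝ, 0 < t → HasDerivAt x ((∫ᵛ u : Icc (-τ) 0, x (t + u) ∂•μ) + f t) t

/-- `x` is the solution `x(·, ψ)` of the delay equation with forcing `f` and initial function
`ψ ∈ C([-τ,0]; ℝ)`. -/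
def IsSolution {τ : ℝ} (μ : SignedMeasure (Icc (-τ) 0)) (f : ℝ → ℝ)
    (ψ : C(Icc (-τ) 0, ℝ)) (x : ℝ → ℝ) : Prop :=
  SolvesDelayEq μ f x ∧ ∀ s : Icc (-τ) 0, x s = ψ s

/-- `r` is the differential resolvent `r_τ` of `μ`: the solution of the unforced equation with
`r(0) = 1` and `r(t) = 0` for `t < 0`. -/
def IsResolvent {τ : ℝ} (μ : SignedMeasure (Icc (-τ) 0)) (r : ℝ → ℝ) : Prop :=
  SolvesDelayEq μ 0 r ∧ r 0 = 1 ∧ ∀ t : ℝ, t < 0 → r t = 0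

end DelayCesaro

end

open DelayCesaro

/-!
The delay operator `ν.delay a t = ∫ a(t + u) μ(du)` commutes with integration up to a constant, so
the primitive `X(t) = ∫₀ᵗ x` of a solution satisfies `X' = ν.delay X + F + c` with `F = ∫₀ᵗ f`, and
`x` has Cesàro limit `l` exactly when `X(t)/t → l`.  Everything is therefore a statement about
functions of asymptotically linear growth, and no characteristic equation is needed.

Suppose the resolvent `r` is integrable.  The integrated resolvent equation expresses `r` through
its primitive, so `r` is bounded and has a limit, necessarily `0`; this gives
`1 + μ([-τ,0]) ∫ r = 0` (`PolarMeasure.IsRes.integral_mul_mass`).  By variation of constants `X`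
differs from the convolution of `r` with the forcing by a bounded term, and convolution with an
integrable kernel preserves asymptotically linear growth.  Hence a forcing `G` of the equation for
`X` with `G(t)/t → g` produces `X(t)/t → -g / μ([-τ,0])`
(`PolarMeasure.IsRes.tendsto_prim_div`).  With `G = F + c` this is the case of a forcing in `Ces`.

If only the interval averages of `f` lie in `Ces`, then the increments `Φ(t + θ) - Φ(t)` of
`Φ = ∫₀ᵗ F` are asymptotically linear for each `θ`.  As in the uniform convergence theorem for
regularly varying functions, Baire's theorem makes the linear bound uniform for small `θ`
(`exists_uniform_increment_bound`), so `Φ(t) - (1/δ)∫_t^{t+δ} Φ` is asymptotically linear by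
dominated convergence.  Subtracting it from `X` leaves a solution whose forcing is asymptotically
linear (`PolarMeasure.IsSol.exists_tendsto_prim_div`).  The reverse implications follow by
integrating the equation.

Conversely, suppose every forcing in `Ces` yields a solution in `Ces`.  For `g` vanishing at
infinity put `K(s) = s⁺ g(s)` and `f(s) = (K(s) - K(s - h)) / h`, which has Cesàro limit `0`.  With
zero initial function the solution is the convolution of `r` and `f`, and its primitive is the
convolution of `K` with the mean `y` of `r` over intervals of length `h`.  The uniform boundedness
principle on `C₀(ℝ, ℝ)` bounds `(1/n) ∫₀ⁿ |y(n - s)| s ds`, hence `∫₀^∞ |y|`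
(`exists_integral_abs_bound`).  The resolvent equation bounds the `L¹` norm of `r - y` on `[h, T]` by
`h |μ|([-τ,0]) ∫₀ᵀ |r|`, which is absorbed when `h` is small
(`PolarMeasure.IsRes.integrableOn_of_mean`).
-/

noncomputable section

namespace DelayCesaro

/-! ### Primitives and convolutions of locally bounded functions -/

section

/-- Measurable functions that are bounded on bounded sets.  Both the continuous functions and the
resolvent, which jumps at `0`, belong to this class. -/
structure LocBdd (a : ℝ → ℝ) : Prop where
  measurable : Measurable a
  bounded : ∀ T : ℝ, ∃ C : ℝ, 0 ≤ C ∧ ∀ s, |s| ≤ T → |a s| ≤ C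

/-- The primitive of `a` that vanishes at `0`. -/
def prim (a : ℝ → ℝ) (t : ℝ) : ℝ := ∫ s in (0 : ℝ)..t, a s

/-- The convolution of two functions on the half-line. -/
def conv (a b : ℝ → ℝ) (t : ℝ) : ℝ := ∫ s in (0 : ℝ)..t, a (t - s) * b s

lemma LocBdd.of_continuous {a : ℝ → ℝ} (ha : Continuous a) : LocBdd a := by
  refine ⟨ha.measurable, fun T => ?_⟩
  obtain ⟨C, hC⟩ := (isCompact_Icc (a := -T) (b := T)).exists_bound_of_continuousOn ha.continuousOn
  exact ⟨max C 0, le_max_right _ _, fun s hs => (hC s (abs_le.mp hs)).trans (le_max_left _ _)⟩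

lemma LocBdd.mul {a b : ℝ → ℝ} (ha : LocBdd a) (hb : LocBdd b) :
    LocBdd (fun s => a s * b s) := by
  refine ⟨ha.measurable.mul hb.measurable, fun T => ?_⟩
  obtain ⟨C, hC, h1⟩ := ha.bounded T
  obtain ⟨D, hD, h2⟩ := hb.bounded T
  exact ⟨C * D, by positivity, fun s hs => by
    rw [abs_mul]; exact mul_le_mul (h1 s hs) (h2 s hs) (abs_nonneg _) hC⟩

lemma LocBdd.comp_continuous {a φ : ℝ → ℝ} (ha : LocBdd a) (hφ : Continuous φ) :
    LocBdd (fun s => a (φ s)) := by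
  refine ⟨ha.measurable.comp hφ.measurable, fun T => ?_⟩
  obtain ⟨D, hD, h2⟩ := (LocBdd.of_continuous hφ).bounded T
  obtain ⟨C, hC, h1⟩ := ha.bounded D
  exact ⟨C, hC, fun s hs => h1 _ (h2 s hs)⟩

lemma LocBdd.intervalIntegrable {a : ℝ → ℝ} (ha : LocBdd a) (s t : ℝ) :
    IntervalIntegrable a volume s t := by
  rw [intervalIntegrable_iff]
  obtain ⟨C, -, hC⟩ := ha.bounded (max |s| |t|)
  refine Measure.integrableOn_of_bounded (M := C) (by simp) ha.measurable.aestronglyMeasurable ?_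
  refine (ae_restrict_iff' measurableSet_uIoc).mpr (Eventually.of_forall fun x hx => hC x ?_)
  rcases le_total s t with h | h
  · rw [uIoc_of_le h] at hx
    exact abs_le_max_abs_abs hx.1.le hx.2
  · rw [uIoc_of_ge h] at hx
    rw [max_comm]; exact abs_le_max_abs_abs hx.1.le hx.2

lemma integrable_uIoc_prod {Ω : Type*} [MeasurableSpace Ω] {m : Measure Ω}
    [IsFiniteMeasure m] {F : ℝ → Ω → ℝ} (hF : Measurable (Function.uncurry F)) {s t C : ℝ}
    (hC : ∀ x ∈ uIoc s t, ∀ᵐ u ∂m, |F x u| ≤ C) :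
    Integrable (Function.uncurry F) ((volume.restrict (uIoc s t)).prod m) := by
  have : IsFiniteMeasure ((volume : Measure ℝ).restrict (uIoc s t)) :=
    ⟨by simp⟩
  refine Integrable.of_bound hF.aestronglyMeasurable C ?_
  rw [Measure.ae_prod_iff_ae_ae (measurableSet_le hF.norm measurable_const)]
  exact (ae_restrict_iff' measurableSet_uIoc).mpr (Eventually.of_forall hC)

lemma conv_comm (a b : ℝ → ℝ) (t : ℝ) : conv a b t = conv b a t := by
  have := intervalIntegral.integral_comp_sub_left (a := 0) (b := t)
    (fun s => a (t - s) * b s) t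
  simp only [sub_sub_cancel, sub_self, sub_zero] at this
  rw [conv, ← this, conv]
  simp only [mul_comm]

lemma LocBdd.indicator_Ici {a : ℝ → ℝ} (ha : LocBdd a) : LocBdd ((Ici (0 : ℝ)).indicator a) := by
  refine ⟨ha.measurable.indicator measurableSet_Ici, fun T => ?_⟩
  obtain ⟨C, hC, h⟩ := ha.bounded T
  refine ⟨C, hC, fun s hs => ?_⟩
  by_cases hs0 : s ∈ Ici (0 : ℝ)
  · rw [indicator_of_mem hs0]; exact h s hs
  · rw [indicator_of_notMem hs0]; simpa using hC

lemma prim_congr {a b : ℝ → ℝ} (h : ∀ s, 0 < s → a s = b s) {t : ℝ} (ht : 0 ≤ t) :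
    prim a t = prim b t := by
  refine intervalIntegral.integral_congr_ae (Eventually.of_forall fun s hs => ?_)
  rw [uIoc_of_le ht] at hs
  exact h s hs.1

lemma prim_indicator (a : ℝ → ℝ) {t : ℝ} (ht : 0 ≤ t) :
    prim ((Ici (0 : ℝ)).indicator a) t = prim a t :=
  prim_congr (fun _ hs => indicator_of_mem (mem_Ici.mpr hs.le) a) ht

lemma conv_indicator (a b : ℝ → ℝ) {t : ℝ} (ht : 0 ≤ t) :
    conv ((Ici (0 : ℝ)).indicator a) b t = conv a b t := by
  refine intervalIntegral.integral_congr_ae (Eventually.of_forall fun s hs => ?_)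
  rw [uIoc_of_le ht] at hs
  rw [indicator_of_mem (mem_Ici.mpr (sub_nonneg.mpr hs.2))]

/-- If `a` vanishes on the negative half-line, the upper limit of the convolution integral may be
enlarged; it is allowed that `w` is negative. -/
lemma conv_causal {a b : ℝ → ℝ} (ha : LocBdd a) (hb : LocBdd b) (h0 : ∀ s, s < 0 → a s = 0)
    {w t : ℝ} (hwt : w ≤ t) : ∫ s in (0 : ℝ)..t, a (w - s) * b s = conv a b w := by
  have hi : ∀ x y, IntervalIntegrable (fun s => a (w - s) * b s) volume x y := fun x y =>
    ((ha.comp_continuous (by fun_prop)).mul hb).intervalIntegrable x y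
  rw [conv, ← intervalIntegral.integral_add_adjacent_intervals (hi 0 w) (hi w t)]
  have : ∫ s in w..t, a (w - s) * b s = 0 := by
    rw [intervalIntegral.integral_congr_ae (g := fun _ => 0)]
    · simp
    · refine Eventually.of_forall fun s hs => ?_
      rw [uIoc_of_le hwt] at hs
      simp [h0 (w - s) (by linarith [hs.1])]
  rw [this, add_zero]

lemma prim_eq_zero_of_nonpos {a : ℝ → ℝ} (h0 : ∀ s, s < 0 → a s = 0) {t : ℝ} (ht : t ≤ 0) :
    prim a t = 0 := by
  rw [prim, intervalIntegral.integral_symm, neg_eq_zero,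
    intervalIntegral.integral_congr_ae (g := fun _ => 0)]
  · simp
  · filter_upwards [compl_mem_ae_iff.mpr (measure_singleton (0 : ℝ))] with w hw0 hw
    rw [uIoc_of_le ht] at hw
    exact h0 w (lt_of_le_of_ne hw.2 hw0)

/-- For causal `a` the convolution integral extends over a fixed interval, which turns the integral
over a triangle into one over a square. -/
lemma prim_conv_causal {a b : ℝ → ℝ} (ha : LocBdd a) (hb : LocBdd b)
    (h0 : ∀ s, s < 0 → a s = 0) {t : ℝ} (ht : 0 ≤ t) :
    prim (conv a b) t = conv (prim a) b t := by
  have h1 : prim (conv a b) t = ∫ w in (0 : ℝ)..t, ∫ s in (0 : ℝ)..t, a (w - s) * b s := by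
    refine intervalIntegral.integral_congr_ae (Eventually.of_forall fun w hw => ?_)
    rw [uIoc_of_le ht] at hw
    exact (conv_causal ha hb h0 hw.2).symm
  rw [h1, intervalIntegral_intervalIntegral_swap]
  · refine intervalIntegral.integral_congr_ae (Eventually.of_forall fun s hs => ?_)
    rw [uIoc_of_le ht] at hs
    simp only [intervalIntegral.integral_mul_const]
    rw [intervalIntegral.integral_comp_sub_right (fun w => a w) s]
    have hz : ∫ w in (0 - s)..0, a w = 0 := by
      rw [intervalIntegral.integral_symm, neg_eq_zero]
      exact prim_eq_zero_of_nonpos h0 (by linarith [hs.1])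
    rw [← intervalIntegral.integral_add_adjacent_intervals (ha.intervalIntegrable (0 - s) 0)
      (ha.intervalIntegrable 0 (t - s)), hz, zero_add]
    rfl
  · obtain ⟨C, hC, h1⟩ := ha.bounded t
    obtain ⟨D, hD, h2⟩ := hb.bounded t
    have : IsFiniteMeasure ((volume : Measure ℝ).restrict (uIoc 0 t)) := ⟨by simp⟩
    rw [IntegrableOn, Measure.volume_eq_prod, ← Measure.prod_restrict]
    refine integrable_uIoc_prod (m := volume.restrict (uIoc 0 t))
      (F := fun w s => a (w - s) * b s) ?_ (C := C * D) ?_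
    · exact (ha.measurable.comp (measurable_fst.sub measurable_snd)).mul
        (hb.measurable.comp measurable_snd)
    · intro w hw
      refine (ae_restrict_iff' measurableSet_uIoc).mpr (Eventually.of_forall fun s hs => ?_)
      rw [uIoc_of_le ht] at hs hw
      rw [abs_mul]
      exact mul_le_mul (h1 _ (abs_le.mpr ⟨by linarith [hs.2, hw.1], by linarith [hs.1, hw.2]⟩))
        (h2 _ (abs_le.mpr ⟨by linarith [hs.1], hs.2⟩)) (abs_nonneg _) hC

lemma LocBdd.continuous_prim {a : ℝ → ℝ} (ha : LocBdd a) : Continuous (prim a) :=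
  intervalIntegral.continuous_primitive (fun s t => ha.intervalIntegrable s t) 0

lemma LocBdd.prim {a : ℝ → ℝ} (ha : LocBdd a) : LocBdd (prim a) :=
  LocBdd.of_continuous ha.continuous_prim

/-- A primitive of a convolution is obtained by integrating the first factor. -/
lemma prim_conv_left {a b : ℝ → ℝ} (ha : LocBdd a) (hb : LocBdd b) {t : ℝ} (ht : 0 ≤ t) :
    prim (conv a b) t = conv (prim a) b t := by
  rw [← prim_congr (a := conv ((Ici (0 : ℝ)).indicator a) b)
      (fun s hs => conv_indicator a b hs.le) ht,
    prim_conv_causal ha.indicator_Ici hb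
      (fun s hs => indicator_of_notMem (by simpa using hs) a) ht]
  refine intervalIntegral.integral_congr_ae (Eventually.of_forall fun s hs => ?_)
  rw [uIoc_of_le ht] at hs
  rw [prim_indicator a (sub_nonneg.mpr hs.2)]

/-- A primitive of a convolution is obtained by integrating the second factor. -/
lemma prim_conv_right {a b : ℝ → ℝ} (ha : LocBdd a) (hb : LocBdd b) {t : ℝ} (ht : 0 ≤ t) :
    prim (conv a b) t = conv a (prim b) t := by
  rw [funext (conv_comm a b), prim_conv_left hb ha ht, conv_comm]

lemma conv_add_right {a b c : ℝ → ℝ} (ha : LocBdd a) (hb : LocBdd b) (hc : LocBdd c) (t : ℝ) :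
    conv a (fun s => b s + c s) t = conv a b t + conv a c t := by
  have h : ∀ {b}, LocBdd b → IntervalIntegrable (fun s => a (t - s) * b s) volume 0 t := fun hb =>
    ((ha.comp_continuous (by fun_prop)).mul hb).intervalIntegrable _ _
  simp only [conv, mul_add]
  exact intervalIntegral.integral_add (h hb) (h hc)

/-- Convolution with a continuous function vanishing on the negative half-line is continuous. -/
lemma continuous_conv {a b : ℝ → ℝ} (ha : LocBdd a) (hb : Continuous b)
    (h0 : ∀ s, s ≤ 0 → b s = 0) : Continuous (conv a b) := by
  rw [continuous_iff_continuousAt]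
  intro t₀
  set T := |t₀| + 1 with hT
  have hbL := LocBdd.of_continuous hb
  have heq : (fun t => ∫ s in (0 : ℝ)..T, b (t - s) * a s) =ᶠ[𝓝 t₀] conv a b := by
    have : Iio T ∈ 𝓝 t₀ := Iio_mem_nhds (by linarith [le_abs_self t₀])
    filter_upwards [this] with t ht
    rw [conv_comm]
    exact conv_causal hbL ha (fun s hs => h0 s hs.le) (le_of_lt ht)
  refine ContinuousAt.congr ?_ heq
  obtain ⟨C, hC, h1⟩ := hbL.bounded (2 * T)
  obtain ⟨D, hD, h2⟩ := ha.bounded T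
  have hT0 : 0 ≤ T := by positivity
  refine intervalIntegral.continuousAt_of_dominated_interval (bound := fun _ => C * D) ?_ ?_ ?_ ?_
  · exact Eventually.of_forall fun t =>
      ((hb.measurable.comp (by fun_prop)).mul ha.measurable).aestronglyMeasurable
  · have : Ioo (-T) T ∈ 𝓝 t₀ := Ioo_mem_nhds (by linarith [neg_abs_le t₀])
      (by linarith [le_abs_self t₀])
    filter_upwards [this] with t ht
    refine Eventually.of_forall fun s hs => ?_
    rw [uIoc_of_le hT0] at hs
    rw [Real.norm_eq_abs, abs_mul]
    exact mul_le_mul (h1 _ (abs_le.mpr ⟨by linarith [hs.2, ht.1], by linarith [hs.1, ht.2]⟩))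
        (h2 _ (abs_le.mpr ⟨by linarith [hs.1], hs.2⟩)) (abs_nonneg _) hC
  · simp
  · exact Eventually.of_forall fun s _ => by fun_prop

end

/-! ### Signed measures and the delay operator -/

section

/-- A finite positive measure on `[-τ, 0]` together with a measurable density of modulus at most
one.  Every finite signed measure on `[-τ, 0]` is of this form, with the total variation and the
sign function of a Hahn decomposition. -/
structure PolarMeasure (τ : ℝ) where
  /-- The positive measure. -/
  m : Measure (Icc (-τ) 0)
  /-- The density. -/
  σ : Icc (-τ) 0 → ℝ
  finite : IsFiniteMeasure m
  measurable : Measurable σ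
  le_one : ∀ u, |σ u| ≤ 1

namespace PolarMeasure

attribute [instance] PolarMeasure.finite

variable {τ : ℝ} (ν : PolarMeasure τ)

/-- The integral of a function against the signed measure with density `σ`. -/
def int (φ : Icc (-τ) 0 → ℝ) : ℝ := ∫ u, ν.σ u * φ u ∂ν.m

/-- The total (signed) mass. -/
def mass : ℝ := ν.int fun _ => 1

/-- The delay operator `t ↦ ∫ a(t + u) μ(du)`. -/
def delay (a : ℝ → ℝ) (t : ℝ) : ℝ := ν.int fun u => a (t + u)

lemma integrable_int {φ : Icc (-τ) 0 → ℝ} (hφ : Measurable φ) {C : ℝ} (hC : ∀ u, |φ u| ≤ C) :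
    Integrable (fun u => ν.σ u * φ u) ν.m := by
  refine Integrable.of_bound (ν.measurable.mul hφ).aestronglyMeasurable C
    (Eventually.of_forall fun u => ?_)
  rw [Real.norm_eq_abs, abs_mul]
  nlinarith [ν.le_one u, hC u, abs_nonneg (ν.σ u), abs_nonneg (φ u)]

lemma abs_int_le {φ : Icc (-τ) 0 → ℝ} {C : ℝ} (hC : ∀ u, |φ u| ≤ C) :
    |ν.int φ| ≤ C * ν.m.real univ := by
  change ‖∫ u, ν.σ u * φ u ∂ν.m‖ ≤ _
  refine norm_integral_le_of_norm_le_const (Eventually.of_forall fun u => ?_)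
  rw [Real.norm_eq_abs, abs_mul]
  nlinarith [ν.le_one u, hC u, abs_nonneg (ν.σ u), abs_nonneg (φ u)]

lemma int_const (c : ℝ) : (ν.int fun _ => c) = c * ν.mass := by
  simp only [mass, int, mul_one]
  rw [integral_mul_const, mul_comm]

lemma int_sub {φ χ : Icc (-τ) 0 → ℝ} (hφ : Measurable φ) (hχ : Measurable χ) {C D : ℝ}
    (hC : ∀ u, |φ u| ≤ C) (hD : ∀ u, |χ u| ≤ D) :
    (ν.int fun u => φ u - χ u) = ν.int φ - ν.int χ := by
  simp only [int, mul_sub]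
  exact integral_sub (ν.integrable_int hφ hC) (ν.integrable_int hχ hD)

lemma measurable_shift {a : ℝ → ℝ} (ha : Measurable a) (t : ℝ) :
    Measurable fun u : Icc (-τ) 0 => a (t + u) :=
  ha.comp (measurable_const.add measurable_subtype_coe)

lemma exists_bound_shift {a : ℝ → ℝ} (ha : LocBdd a) (T : ℝ) :
    ∃ C : ℝ, 0 ≤ C ∧ ∀ t, |t| ≤ T → ∀ u : Icc (-τ) 0, |a (t + u)| ≤ C := by
  obtain ⟨C, hC, h⟩ := ha.bounded (T + |τ|)
  refine ⟨C, hC, fun t ht u => h _ ((abs_add_le _ _).trans (add_le_add ht ?_))⟩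
  rw [abs_of_nonpos u.2.2]
  exact le_trans (by linarith [u.2.1]) (le_abs_self τ)

lemma locBdd_delay {a : ℝ → ℝ} (ha : LocBdd a) : LocBdd (ν.delay a) := by
  constructor
  · have : Measurable (fun p : ℝ × Icc (-τ) 0 => ν.σ p.2 * a (p.1 + p.2)) :=
      (ν.measurable.comp measurable_snd).mul
        (ha.measurable.comp (measurable_fst.add (measurable_subtype_coe.comp measurable_snd)))
    exact this.stronglyMeasurable.integral_prod_right.measurable
  · intro T
    obtain ⟨C, hC, h⟩ := exists_bound_shift (τ := τ) ha T
    exact ⟨C * ν.m.real univ, by positivity, fun s hs => ν.abs_int_le (h s hs)⟩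

lemma delay_sub {a b : ℝ → ℝ} (ha : LocBdd a) (hb : LocBdd b) (t : ℝ) :
    ν.delay (fun s => a s - b s) t = ν.delay a t - ν.delay b t := by
  obtain ⟨C, -, h⟩ := exists_bound_shift (τ := τ) ha |t|
  obtain ⟨D, -, h'⟩ := exists_bound_shift (τ := τ) hb |t|
  exact ν.int_sub (measurable_shift ha.measurable t) (measurable_shift hb.measurable t)
    (h t le_rfl) (h' t le_rfl)

lemma continuous_delay {a : ℝ → ℝ} (ha : Continuous a) : Continuous (ν.delay a) := by
  rw [continuous_iff_continuousAt]
  intro t₀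
  obtain ⟨C, hC, h⟩ := exists_bound_shift (τ := τ) (LocBdd.of_continuous ha) (|t₀| + 1)
  refine continuousAt_of_dominated (bound := fun _ => C) ?_ ?_ (integrable_const _) ?_
  · exact Eventually.of_forall fun t =>
      (ν.measurable.mul (measurable_shift ha.measurable t)).aestronglyMeasurable
  · have : Ioo (t₀ - 1) (t₀ + 1) ∈ 𝓝 t₀ := Ioo_mem_nhds (by linarith) (by linarith)
    filter_upwards [this] with t ht
    have ht' : |t| ≤ |t₀| + 1 := abs_le.mpr
      ⟨by linarith [neg_abs_le t₀, ht.1], by linarith [le_abs_self t₀, ht.2]⟩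
    refine Eventually.of_forall fun u => ?_
    rw [Real.norm_eq_abs, abs_mul]
    nlinarith [ν.le_one u, h t ht' u, abs_nonneg (ν.σ u), abs_nonneg (a (t + u))]
  · exact Eventually.of_forall fun u => by fun_prop

/-- Fubini's theorem for the delay operator and an integral over a bounded interval. -/
lemma integral_delay_mul {a b φ : ℝ → ℝ} (ha : LocBdd a) (hb : LocBdd b) (hφ : Continuous φ)
    (s t : ℝ) :
    ∫ w in s..t, ν.delay a (φ w) * b w = ν.int fun u => ∫ w in s..t, a (φ w + u) * b w := by
  have h1 : ∫ w in s..t, ν.delay a (φ w) * b w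
      = ∫ w in s..t, ∫ u, ν.σ u * (a (φ w + u) * b w) ∂ν.m := by
    refine intervalIntegral.integral_congr fun w _ => ?_
    simp only [delay, int]
    rw [← integral_mul_const]
    simp only [mul_assoc]
  rw [h1, intervalIntegral_integral_swap]
  · simp only [int, intervalIntegral.integral_const_mul]
  · obtain ⟨T, -, hT⟩ := (LocBdd.of_continuous hφ).bounded (max |s| |t|)
    obtain ⟨C, hC, h⟩ := exists_bound_shift (τ := τ) ha T
    obtain ⟨D, hD, h'⟩ := hb.bounded (max |s| |t|)
    refine integrable_uIoc_prod (F := fun w u => ν.σ u * (a (φ w + u) * b w)) ?_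
      (C := C * D) ?_
    · refine (ν.measurable.comp measurable_snd).mul (Measurable.mul ?_ ?_)
      · exact ha.measurable.comp ((hφ.measurable.comp measurable_fst).add
          (measurable_subtype_coe.comp measurable_snd))
      · exact hb.measurable.comp measurable_fst
    · intro w hw
      have hw' : |w| ≤ max |s| |t| := by
        rcases le_total s t with hst | hst
        · rw [uIoc_of_le hst] at hw
          exact abs_le_max_abs_abs hw.1.le hw.2
        · rw [uIoc_of_ge hst] at hw
          rw [max_comm]; exact abs_le_max_abs_abs hw.1.le hw.2
      refine Eventually.of_forall fun u => ?_
      have h3 : |a (φ w + u) * b w| ≤ C * D := by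
        rw [abs_mul]
        exact mul_le_mul (h _ (hT w hw') u) (h' w hw') (abs_nonneg _) hC
      rw [abs_mul]
      nlinarith [ν.le_one u, abs_nonneg (ν.σ u), abs_nonneg (a (φ w + u) * b w)]

lemma conv_delay_left {a b : ℝ → ℝ} (ha : LocBdd a) (hb : LocBdd b) (t : ℝ) :
    conv (ν.delay a) b t = ν.int fun u => ∫ w in (0 : ℝ)..t, a (t - w + u) * b w :=
  ν.integral_delay_mul ha hb (by fun_prop) 0 t

lemma conv_delay_right {a b : ℝ → ℝ} (ha : LocBdd a) (hb : LocBdd b) (t : ℝ) :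
    conv b (ν.delay a) t = ν.int fun u => ∫ w in (0 : ℝ)..t, b (t - w) * a (w + u) := by
  have := ν.integral_delay_mul ha (hb.comp_continuous (φ := fun w => t - w) (by fun_prop))
    continuous_id 0 t
  simp only [id] at this
  simp only [conv, mul_comm (b _)]
  exact this

/-- The delay operator commutes with integration, up to an additive constant. -/
lemma prim_delay {a : ℝ → ℝ} (ha : LocBdd a) (t : ℝ) :
    prim (ν.delay a) t = ν.delay (prim a) t - ν.delay (prim a) 0 := by
  have h1 := ν.integral_delay_mul ha (LocBdd.of_continuous (continuous_const (y := (1 : ℝ))))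
    continuous_id 0 t
  simp only [mul_one, id] at h1
  rw [prim, h1]
  obtain ⟨C, -, h⟩ := exists_bound_shift (τ := τ) ha.prim |t|
  obtain ⟨D, -, h'⟩ := exists_bound_shift (τ := τ) ha.prim 0
  rw [delay, delay, ← ν.int_sub (measurable_shift ha.prim.measurable t)
    (measurable_shift ha.prim.measurable 0) (h t le_rfl) (h' 0 (by simp))]
  congr 1
  funext u
  rw [intervalIntegral.integral_comp_add_right (fun w => a w), prim, prim,
    intervalIntegral.integral_interval_sub_left (ha.intervalIntegrable _ _)
      (ha.intervalIntegrable _ _)]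

/-- The polar measure `ν` represents the signed measure `μ`: the integrals of all bounded
measurable functions agree. -/
def Represents (ν : PolarMeasure τ) (μ : SignedMeasure (Icc (-τ) 0)) : Prop :=
  ∀ (φ : Icc (-τ) 0 → ℝ) (C : ℝ), Measurable φ → (∀ u, |φ u| ≤ C) →
    ∫ᵛ u, φ u ∂•μ = ν.int φ

/-- By the Jordan decomposition, every signed measure is represented by a polar measure. -/
lemma exists_represents (μ : SignedMeasure (Icc (-τ) 0)) :
    ∃ ν : PolarMeasure τ, μ univ = ν.mass ∧ ν.Represents μ := by
  set p := μ.toJordanDecomposition.posPart with hp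
  set n := μ.toJordanDecomposition.negPart with hn
  obtain ⟨S, hS, hpS, hnS⟩ := μ.toJordanDecomposition.mutuallySingular
  have hμ : μ = p.toSignedMeasure - n.toSignedMeasure :=
    μ.toSignedMeasure_toJordanDecomposition.symm
  have hb : ∀ q : Measure (Icc (-τ) 0), IsFiniteMeasure q → ∀ (φ : Icc (-τ) 0 → ℝ) (C : ℝ),
      Measurable φ → (∀ u, |φ u| ≤ C) → Integrable φ q := fun q _ φ C h h' =>
    Integrable.of_bound h.aestronglyMeasurable C (Eventually.of_forall h')
  -- `S` is a negative set of a Hahn decomposition.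
  let σ : Icc (-τ) 0 → ℝ := fun u => S.indicator (fun _ => -1) u + Sᶜ.indicator (fun _ => 1) u
  have hσ : Measurable σ :=
    (measurable_const.indicator hS).add (measurable_const.indicator hS.compl)
  have hσS : ∀ u, u ∈ S → σ u = -1 := fun u hu => by simp [σ, hu]
  have hσS' : ∀ u, u ∉ S → σ u = 1 := fun u hu => by simp [σ, hu]
  have hσ1 : ∀ u, |σ u| ≤ 1 := fun u => by
    by_cases hu : u ∈ S
    · simp [hσS u hu]
    · simp [hσS' u hu]
  let ν : PolarMeasure τ := ⟨p + n, σ, inferInstance, hσ, hσ1⟩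
  have key : ∀ (φ : Icc (-τ) 0 → ℝ) (C : ℝ), Measurable φ → (∀ u, |φ u| ≤ C) →
      ν.int φ = ∫ u, φ u ∂p - ∫ u, φ u ∂n := by
    intro φ C hφ hC
    have hi : ∀ q : Measure (Icc (-τ) 0), IsFiniteMeasure q →
        Integrable (fun u => σ u * φ u) q := fun q hq =>
      hb q hq _ C (hσ.mul hφ) fun u => by
        rw [abs_mul]
        nlinarith [hσ1 u, hC u, abs_nonneg (σ u), abs_nonneg (φ u)]
    have h1 : ν.int φ = ∫ u, σ u * φ u ∂p + ∫ u, σ u * φ u ∂n :=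
      integral_add_measure (hi p inferInstance) (hi n inferInstance)
    have h2 : ∫ u, σ u * φ u ∂p = ∫ u, φ u ∂p := by
      refine integral_congr_ae ?_
      have : ∀ᵐ u ∂p, u ∉ S := measure_eq_zero_iff_ae_notMem.mp hpS
      filter_upwards [this] with u hu
      simp [hσS' u hu]
    have h3 : ∫ u, σ u * φ u ∂n = -∫ u, φ u ∂n := by
      rw [← integral_neg]
      refine integral_congr_ae ?_
      have : ∀ᵐ u ∂n, u ∉ Sᶜ := measure_eq_zero_iff_ae_notMem.mp hnS
      filter_upwards [this] with u hu
      simp [hσS u (not_notMem.mp hu)]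
    rw [h1, h2, h3, sub_eq_add_neg]
  -- Mathlib computes the integral against a positive measure for the flipped pairing.
  have hflip : (ContinuousLinearMap.lsmul ℝ ℝ : ℝ →L[ℝ] ℝ →L[ℝ] ℝ)
      = (ContinuousLinearMap.lsmul ℝ ℝ : ℝ →L[ℝ] ℝ →L[ℝ] ℝ).flip := by
    ext; simp
  refine ⟨ν, ?_, fun φ C hφ hC => ?_⟩
  · rw [mass, key (fun _ => 1) 1 measurable_const (by simp), hμ]
    simp
  · rw [key φ C hφ hC]
    conv_lhs => rw [hμ]
    rw [VectorMeasure.integral_sub_vectorMeasure, hflip, VectorMeasure.integral_toSignedMeasure,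
      VectorMeasure.integral_toSignedMeasure]
    · rw [VectorMeasure.Integrable, Measure.variation_toSignedMeasure]
      exact hb p inferInstance φ C hφ hC
    · rw [VectorMeasure.Integrable, Measure.variation_toSignedMeasure]
      exact hb n inferInstance φ C hφ hC

end PolarMeasure

end

/-! ### Asymptotically linear growth and the integrable resolvent -/

section

lemma measurable_integral_left {Ω : Type*} [MeasurableSpace Ω] {F : ℝ → Ω → ℝ}
    (hF : Measurable (Function.uncurry F)) {t : ℝ} (ht : 0 ≤ t) :
    Measurable fun u => ∫ w in (0 : ℝ)..t, F w u := by
  simp only [intervalIntegral.integral_of_le ht]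
  exact hF.stronglyMeasurable.integral_prod_left.measurable

lemma tendsto_shift_div {Y : ℝ → ℝ} {l : ℝ} (h : Tendsto (fun t => Y t / t) atTop (𝓝 l)) (c : ℝ) :
    Tendsto (fun t => Y (t + c) / t) atTop (𝓝 l) := by
  have h1 : Tendsto (fun t : ℝ => Y (t + c) / (t + c)) atTop (𝓝 l) :=
    h.comp (tendsto_atTop_add_const_right _ c tendsto_id)
  have h2 : Tendsto (fun t : ℝ => 1 + c / t) atTop (𝓝 (1 + 0)) :=
    tendsto_const_nhds.add (tendsto_const_nhds.div_atTop tendsto_id)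
  have h3 := h1.mul h2
  rw [add_zero, mul_one] at h3
  refine h3.congr' ?_
  filter_upwards [eventually_gt_atTop 0, eventually_gt_atTop (-c)] with t ht ht'
  have : t + c ≠ 0 := by linarith
  field_simp

lemma tendsto_const_div_atTop (c : ℝ) : Tendsto (fun t : ℝ => c / t) atTop (𝓝 0) :=
  tendsto_const_nhds.div_atTop tendsto_id

lemma exists_linear_bound_eventually {Y : ℝ → ℝ} {l : ℝ}
    (h : Tendsto (fun t => Y t / t) atTop (𝓝 l)) :
    ∃ C T : ℝ, 0 ≤ C ∧ 0 < T ∧ ∀ t, T ≤ t → |Y t| ≤ C * t := by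
  have h1 : ∀ᶠ t in atTop, |Y t / t| < |l| + 1 := h.abs.eventually_lt_const (by linarith)
  obtain ⟨T, hT⟩ := eventually_atTop.mp h1
  refine ⟨|l| + 1, max T 1, by positivity, by positivity, fun t ht => ?_⟩
  have ht0 : 0 < t := lt_of_lt_of_le (by positivity) ht
  have := hT t ((le_max_left _ _).trans ht)
  rw [abs_div, abs_of_pos ht0, div_lt_iff₀ ht0] at this
  exact this.le

lemma exists_linear_bound {Y : ℝ → ℝ} {l : ℝ} (hY : LocBdd Y)
    (h : Tendsto (fun t => Y t / t) atTop (𝓝 l)) :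
    ∃ C : ℝ, 0 ≤ C ∧ ∀ t, 0 ≤ t → |Y t| ≤ C * (1 + t) := by
  obtain ⟨C, T, hC, hT, h1⟩ := exists_linear_bound_eventually h
  obtain ⟨D, hD, h2⟩ := hY.bounded T
  refine ⟨C + D, by positivity, fun t ht => ?_⟩
  rcases le_total T t with h3 | h3
  · nlinarith [h1 t h3]
  · nlinarith [h2 t (abs_le.mpr ⟨by linarith, h3⟩)]

/-- The delay operator multiplies the slope of an asymptotically linear function by the total
mass. -/
lemma PolarMeasure.tendsto_delay_div {τ : ℝ} (ν : PolarMeasure τ) {Y : ℝ → ℝ} {l : ℝ}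
    (hY : LocBdd Y) (h : Tendsto (fun t => Y t / t) atTop (𝓝 l)) :
    Tendsto (fun t => ν.delay Y t / t) atTop (𝓝 (l * ν.mass)) := by
  obtain ⟨C, T, hC, hT, h1⟩ := exists_linear_bound_eventually h
  have heq : (fun t => ν.delay Y t / t)
      = fun t => ∫ u, ν.σ u * (Y (t + u) / t) ∂ν.m := by
    funext t
    simp only [delay, int]
    rw [← integral_div]
    simp only [mul_div_assoc]
  rw [heq, ← ν.int_const]
  refine tendsto_integral_filter_of_dominated_convergence (bound := fun _ => C) ?_ ?_
    (integrable_const _) ?_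
  · exact Eventually.of_forall fun t =>
      (ν.measurable.mul ((measurable_shift hY.measurable t).div_const t)).aestronglyMeasurable
  · filter_upwards [eventually_ge_atTop (T + |τ|)] with t ht
    refine Eventually.of_forall fun u => ?_
    have hu1 : -|τ| ≤ (u : ℝ) := (neg_le_neg (le_abs_self τ)).trans u.2.1
    have hu2 : (u : ℝ) ≤ 0 := u.2.2
    have ht0 : 0 < t := by linarith [abs_nonneg τ]
    have h2 : |Y (t + u) / t| ≤ C := by
      rw [abs_div, abs_of_pos ht0, div_le_iff₀ ht0]
      exact (h1 (t + u) (by linarith)).trans (mul_le_mul_of_nonneg_left (by linarith) hC)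
    rw [Real.norm_eq_abs, abs_mul]
    nlinarith [ν.le_one u, abs_nonneg (ν.σ u), abs_nonneg (Y (t + u) / t)]
  · exact Eventually.of_forall fun u => (tendsto_shift_div h u).const_mul _

/-- Convolution with an integrable kernel preserves asymptotically linear growth. -/
lemma tendsto_conv_div {k G : ℝ → ℝ} {g : ℝ} (hk : LocBdd k) (hki : IntegrableOn k (Ioi 0))
    (hG : LocBdd G) (h : Tendsto (fun t => G t / t) atTop (𝓝 g)) :
    Tendsto (fun t => conv k G t / t) atTop (𝓝 (g * ∫ s in Ioi (0 : ℝ), k s)) := by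
  obtain ⟨C, hC, h1⟩ := exists_linear_bound hG h
  have heq : (fun t => ∫ s in Ioi (0 : ℝ), (Iic t).indicator (fun s => G (t - s) / t * k s) s)
      =ᶠ[atTop] fun t => conv k G t / t := by
    filter_upwards [eventually_ge_atTop 0] with t ht
    rw [setIntegral_indicator measurableSet_Iic, Ioi_inter_Iic, conv_comm, conv,
      intervalIntegral.integral_of_le ht, ← integral_div]
    congr 1
    funext s
    ring
  rw [← integral_const_mul]
  refine Tendsto.congr' heq ?_
  refine tendsto_integral_filter_of_dominated_convergence (bound := fun s => 2 * C * |k s|) ?_ ?_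
    (hki.abs.const_mul _) ?_
  · exact Eventually.of_forall fun t => ((((hG.measurable.comp (by fun_prop)).div_const t).mul
      hk.measurable).indicator measurableSet_Iic).aestronglyMeasurable
  · filter_upwards [eventually_ge_atTop 1] with t ht
    refine (ae_restrict_iff' measurableSet_Ioi).mpr (Eventually.of_forall fun s hs => ?_)
    have hs0 : 0 < s := hs
    by_cases hst : s ∈ Iic t
    · have hst' : s ≤ t := hst
      rw [indicator_of_mem hst, Real.norm_eq_abs, abs_mul]
      refine mul_le_mul_of_nonneg_right ?_ (abs_nonneg _)
      rw [abs_div, abs_of_pos (by linarith : 0 < t), div_le_iff₀ (by linarith)]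
      refine (h1 (t - s) (by linarith)).trans ?_
      nlinarith [mul_nonneg hC hs0.le, mul_nonneg hC (sub_nonneg.mpr ht)]
    · rw [indicator_of_notMem hst]
      simp only [norm_zero]
      positivity
  · refine Eventually.of_forall fun s => ?_
    have h2 := tendsto_shift_div h (-s)
    refine (h2.mul_const (k s)).congr' ?_
    filter_upwards [eventually_ge_atTop s] with t ht
    rw [indicator_of_mem (mem_Iic.mpr ht), sub_eq_add_neg]

/-- The integrated form of the resolvent equation. -/
structure PolarMeasure.IsRes {τ : ℝ} (ν : PolarMeasure τ) (r : ℝ → ℝ) : Prop where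
  locBdd : LocBdd r
  neg : ∀ t, t < 0 → r t = 0
  eq : ∀ t, 0 ≤ t → r t = 1 + prim (ν.delay r) t

namespace PolarMeasure.IsRes

variable {τ : ℝ} {ν : PolarMeasure τ} {r : ℝ → ℝ}

lemma prim_nonpos (h : ν.IsRes r) {t : ℝ} (ht : t ≤ 0) : prim r t = 0 :=
  prim_eq_zero_of_nonpos h.neg ht

lemma eq_delay (h : ν.IsRes r) {t : ℝ} (ht : 0 ≤ t) : r t = 1 + ν.delay (prim r) t := by
  have : ν.delay (prim r) 0 = 0 := by
    rw [delay]
    have : (fun u : Icc (-τ) 0 => prim r (0 + u)) = fun _ => 0 := by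
      funext u
      exact h.prim_nonpos (by simpa using u.2.2)
    rw [this, ν.int_const, zero_mul]
  rw [h.eq t ht, ν.prim_delay h.locBdd, this, sub_zero]

lemma abs_prim_le (h : ν.IsRes r) (hi : IntegrableOn r (Ioi 0)) (t : ℝ) :
    |prim r t| ≤ ∫ s in Ioi (0 : ℝ), |r s| := by
  rcases le_total t 0 with ht | ht
  · rw [h.prim_nonpos ht, abs_zero]
    exact integral_nonneg fun _ => abs_nonneg _
  · rw [prim]
    refine (intervalIntegral.abs_integral_le_integral_abs ht).trans ?_
    rw [intervalIntegral.integral_of_le ht]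
    exact setIntegral_mono_set hi.abs (Eventually.of_forall fun _ => abs_nonneg _)
      Ioc_subset_Ioi_self.eventuallyLE

/-- An integrable resolvent is bounded. -/
lemma bounded (h : ν.IsRes r) (hi : IntegrableOn r (Ioi 0)) :
    ∃ C : ℝ, 0 ≤ C ∧ ∀ t, |r t| ≤ C := by
  have hB : 0 ≤ ∫ s in Ioi (0 : ℝ), |r s| := integral_nonneg fun _ => abs_nonneg _
  refine ⟨1 + (∫ s in Ioi (0 : ℝ), |r s|) * ν.m.real univ, by positivity, fun t => ?_⟩
  rcases lt_or_ge t 0 with ht | ht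
  · rw [h.neg t ht, abs_zero]; positivity
  · rw [h.eq_delay ht]
    refine (abs_add_le _ _).trans (add_le_add (by simp) ?_)
    exact ν.abs_int_le fun u => h.abs_prim_le hi _

/-- Since an integrable resolvent tends to a limit, that limit is zero; the integrated equation
then determines the integral of the resolvent. -/
lemma integral_mul_mass (h : ν.IsRes r) (hi : IntegrableOn r (Ioi 0)) :
    1 + (∫ s in Ioi (0 : ℝ), r s) * ν.mass = 0 := by
  have hR : Tendsto (prim r) atTop (𝓝 (∫ s in Ioi (0 : ℝ), r s)) :=
    intervalIntegral_tendsto_integral_Ioi 0 hi tendsto_id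
  have hd : Tendsto (ν.delay (prim r)) atTop (𝓝 ((∫ s in Ioi (0 : ℝ), r s) * ν.mass)) := by
    rw [← ν.int_const]
    refine tendsto_integral_filter_of_dominated_convergence
      (bound := fun _ => ∫ s in Ioi (0 : ℝ), |r s|) ?_ ?_ (integrable_const _) ?_
    · exact Eventually.of_forall fun t => (ν.measurable.mul
        (measurable_shift h.locBdd.continuous_prim.measurable t)).aestronglyMeasurable
    · refine Eventually.of_forall fun t => Eventually.of_forall fun u => ?_
      rw [Real.norm_eq_abs, abs_mul]
      nlinarith [ν.le_one u, h.abs_prim_le hi (t + u), abs_nonneg (ν.σ u),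
        abs_nonneg (prim r (t + u))]
    · exact Eventually.of_forall fun u =>
        (hR.comp (tendsto_atTop_add_const_right _ _ tendsto_id)).const_mul _
  have hr : Tendsto r atTop (𝓝 (1 + (∫ s in Ioi (0 : ℝ), r s) * ν.mass)) := by
    refine (hd.const_add 1).congr' ?_
    filter_upwards [eventually_ge_atTop 0] with t ht
    exact (h.eq_delay ht).symm
  have hat : IntegrableAtFilter r atTop volume := ⟨Ioi 0, Ioi_mem_atTop 0, hi⟩
  refine hat.eq_zero_of_tendsto (fun s hs => ?_) hr
  obtain ⟨b, hb⟩ := mem_atTop_sets.mp hs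
  exact measure_mono_top (fun x hx => hb x hx) (Real.volume_Ici (a := b))

/-- The variation of constants formula for the primitive `X` of `y`, up to the contribution of the
initial values of `X`. -/
lemma sub_conv_eq (h : ν.IsRes r) {y G : ℝ → ℝ} (hy : LocBdd y) (hG : LocBdd G)
    (he : ∀ t, 0 ≤ t → y t = ν.delay (prim y) t + G t) {t : ℝ} (ht : 0 ≤ t) :
    prim y t - conv r G t
      = conv r (ν.delay (prim y)) t - conv (ν.delay r) (prim y) t := by
  have hρ := ν.locBdd_delay h.locBdd
  -- Insert `r = 1 + ∫ ν.delay r` and move the integral to the other factor.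
  have h1 : conv r y t = prim y t + conv (ν.delay r) (prim y) t := by
    rw [← prim_conv_right hρ hy ht, prim_conv_left hρ hy ht]
    have hpi : IntervalIntegrable (fun s => prim (ν.delay r) (t - s) * y s) volume 0 t :=
      ((hρ.prim.comp_continuous (by fun_prop)).mul hy).intervalIntegrable _ _
    simp only [prim, conv] at hpi ⊢
    rw [← intervalIntegral.integral_add (hy.intervalIntegrable 0 t) hpi]
    refine intervalIntegral.integral_congr_ae (Eventually.of_forall fun s hs => ?_)
    rw [uIoc_of_le ht] at hs
    have := h.eq (t - s) (by linarith [hs.2])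
    simp only [prim] at this
    simp only [this]
    ring
  have h2 : conv r y t = conv r (ν.delay (prim y)) t + conv r G t := by
    rw [← conv_add_right h.locBdd (ν.locBdd_delay hy.prim) hG]
    refine intervalIntegral.integral_congr_ae (Eventually.of_forall fun s hs => ?_)
    rw [uIoc_of_le ht] at hs
    simp only [he s hs.1.le]
  linarith

/-- The two convolution integrals in `sub_conv_eq` differ by an integral over the initial interval
only, which is bounded when the resolvent is. -/
lemma exists_bound_sub_conv (h : ν.IsRes r) (hi : IntegrableOn r (Ioi 0)) {y G : ℝ → ℝ}
    (hy : LocBdd y) (hG : LocBdd G) (he : ∀ t, 0 ≤ t → y t = ν.delay (prim y) t + G t) :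
    ∃ D : ℝ, ∀ t, |τ| ≤ t → |prim y t - conv r G t| ≤ D := by
  obtain ⟨C, hC, hr⟩ := h.bounded hi
  obtain ⟨D, hD, hX⟩ := hy.prim.bounded |τ|
  refine ⟨C * D * |τ| * ν.m.real univ, fun t ht => ?_⟩
  have ht0 : 0 ≤ t := (abs_nonneg τ).trans ht
  have hXL := hy.prim
  rw [h.sub_conv_eq hy hG he ht0, ν.conv_delay_right hXL h.locBdd,
    ν.conv_delay_left h.locBdd hXL]
  have hprod : ∀ c : ℝ, LocBdd (fun w => r (c - w) * prim y w) := fun c =>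
    (h.locBdd.comp_continuous (by fun_prop)).mul hXL
  have hL : ∀ u : ℝ, ∫ w in (0 : ℝ)..t, r (t - w) * prim y (w + u)
      = ∫ w in u..t + u, r (t + u - w) * prim y w := fun u => by
    have := intervalIntegral.integral_comp_add_right (a := 0) (b := t)
      (fun w => r (t + u - w) * prim y w) u
    rw [zero_add] at this
    rw [← this]
    congr 1
    funext w
    rw [add_sub_add_right_eq_sub]
  have hR : ∀ u : ℝ, u ≤ 0 → ∫ w in (0 : ℝ)..t, r (t - w + u) * prim y w
      = ∫ w in (0 : ℝ)..t + u, r (t + u - w) * prim y w := fun u hu => by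
    have := conv_causal h.locBdd hXL h.neg (w := t + u) (t := t) (by linarith)
    rw [conv] at this
    rw [← this]
    congr 1
    funext w
    congr 2
    ring
  have hbound : ∀ u : Icc (-τ) 0, ∀ w ∈ uIoc (u : ℝ) 0,
      ‖r (t + u - w) * prim y w‖ ≤ C * D := fun u w hw => by
    rw [uIoc_of_le u.2.2] at hw
    rw [Real.norm_eq_abs, abs_mul]
    exact mul_le_mul (hr _) (hX w (abs_le.mpr
      ⟨by linarith [hw.1, u.2.1, le_abs_self τ], by linarith [hw.2, abs_nonneg τ]⟩))
      (abs_nonneg _) hC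
  have hdiff : ∀ u : Icc (-τ) 0, (∫ w in (0 : ℝ)..t, r (t - w) * prim y (w + u))
      - ∫ w in (0 : ℝ)..t, r (t - w + u) * prim y w
      = ∫ w in (u : ℝ)..0, r (t + u - w) * prim y w := fun u => by
    rw [hL, hR u u.2.2, ← intervalIntegral.integral_add_adjacent_intervals
      ((hprod (t + u)).intervalIntegrable u 0) ((hprod (t + u)).intervalIntegrable 0 (t + u))]
    ring
  have hsub : (ν.int fun u => ∫ w in (0 : ℝ)..t, r (t - w) * prim y (w + u))
      - (ν.int fun u => ∫ w in (0 : ℝ)..t, r (t - w + u) * prim y w)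
      = ν.int fun u => ∫ w in (u : ℝ)..0, r (t + u - w) * prim y w := by
    obtain ⟨E, -, hE⟩ := exists_bound_shift (τ := τ) hXL t
    have hC' : ∀ u : Icc (-τ) 0, |∫ w in (0 : ℝ)..t, r (t - w) * prim y (w + u)|
        ≤ C * E * |t - 0| := fun u => by
      rw [← Real.norm_eq_abs]
      refine intervalIntegral.norm_integral_le_of_norm_le_const fun w hw => ?_
      rw [uIoc_of_le ht0] at hw
      rw [Real.norm_eq_abs, abs_mul]
      exact mul_le_mul (hr _) (hE w (abs_le.mpr ⟨by linarith [hw.1], hw.2⟩) u) (abs_nonneg _) hC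
    obtain ⟨D', -, hX'⟩ := hXL.bounded t
    have hC'' : ∀ u : Icc (-τ) 0, |∫ w in (0 : ℝ)..t, r (t - w + u) * prim y w|
        ≤ C * D' * |t - 0| := fun u => by
      rw [← Real.norm_eq_abs]
      refine intervalIntegral.norm_integral_le_of_norm_le_const fun w hw => ?_
      rw [uIoc_of_le ht0] at hw
      rw [Real.norm_eq_abs, abs_mul]
      exact mul_le_mul (hr _) (hX' w (abs_le.mpr ⟨by linarith [hw.1], hw.2⟩)) (abs_nonneg _) hC
    rw [← ν.int_sub (measurable_integral_left
        (F := fun w (u : Icc (-τ) 0) => r (t - w) * prim y (w + u)) ?_ ht0)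
      (measurable_integral_left
        (F := fun w (u : Icc (-τ) 0) => r (t - w + u) * prim y w) ?_ ht0) hC' hC'']
    · simp only [hdiff]
    · exact (h.locBdd.measurable.comp (measurable_const.sub measurable_fst)).mul
        (hXL.measurable.comp (measurable_fst.add (measurable_subtype_coe.comp measurable_snd)))
    · exact (h.locBdd.measurable.comp ((measurable_const.sub measurable_fst).add
        (measurable_subtype_coe.comp measurable_snd))).mul (hXL.measurable.comp measurable_fst)
  rw [hsub]
  refine ν.abs_int_le fun u => ?_
  refine (intervalIntegral.norm_integral_le_of_norm_le_const (hbound u)).trans ?_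
  refine mul_le_mul_of_nonneg_left ?_ (by positivity)
  rw [zero_sub, abs_neg, abs_of_nonpos u.2.2]
  exact (by linarith [u.2.1] : -(u : ℝ) ≤ τ).trans (le_abs_self τ)

/-- If the resolvent is integrable and the forcing `G` of the equation satisfied by `X = prim y` is
asymptotically linear, then so is `X`, and the slopes are related by `mass * x = -g`. -/
lemma tendsto_prim_div (h : ν.IsRes r) (hi : IntegrableOn r (Ioi 0)) {y G : ℝ → ℝ} {g : ℝ}
    (hy : LocBdd y) (hG : LocBdd G) (he : ∀ t, 0 ≤ t → y t = ν.delay (prim y) t + G t)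
    (hg : Tendsto (fun t => G t / t) atTop (𝓝 g)) :
    Tendsto (fun t => prim y t / t) atTop (𝓝 (-g / ν.mass)) := by
  obtain ⟨D, hD⟩ := h.exists_bound_sub_conv hi hy hG he
  have hm := h.integral_mul_mass hi
  have hm0 : ν.mass ≠ 0 := fun h0 => by simp [h0] at hm
  have h1 := tendsto_conv_div h.locBdd hi hG hg
  have h2 : Tendsto (fun t => (prim y t - conv r G t) / t) atTop (𝓝 0) := by
    refine squeeze_zero_norm' ?_ (tendsto_const_div_atTop D)
    filter_upwards [eventually_ge_atTop |τ|, eventually_gt_atTop 0] with t ht ht0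
    rw [Real.norm_eq_abs, abs_div, abs_of_pos ht0]
    exact div_le_div_of_nonneg_right (hD t ht) ht0.le
  have h3 := h1.add h2
  have : -g / ν.mass = g * (∫ s in Ioi (0 : ℝ), r s) + 0 := by
    rw [div_eq_iff hm0]
    linear_combination (-g) * hm
  rw [this]
  refine h3.congr fun t => ?_
  ring

end PolarMeasure.IsRes

end

/-! ### Solutions with a continuous extension and their Cesàro means -/

section

lemma continuous_prim {f : ℝ → ℝ} (hf : ∀ a b, IntervalIntegrable f volume a b) :
    Continuous (prim f) :=
  intervalIntegral.continuous_primitive hf 0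

lemma prim_sub {a b : ℝ → ℝ} (ha : LocBdd a) (hb : LocBdd b) (t : ℝ) :
    prim (fun s => a s - b s) t = prim a t - prim b t :=
  intervalIntegral.integral_sub (ha.intervalIntegrable 0 t) (hb.intervalIntegrable 0 t)

lemma prim_const_mul (c : ℝ) (a : ℝ → ℝ) (t : ℝ) :
    prim (fun s => c * a s) t = c * prim a t :=
  intervalIntegral.integral_const_mul c a

lemma prim_comp_add {a : ℝ → ℝ} (ha : LocBdd a) (θ t : ℝ) :
    prim (fun s => a (s + θ)) t = prim a (t + θ) - prim a θ := by
  rw [prim, intervalIntegral.integral_comp_add_right (fun s => a s), zero_add, prim, prim,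
    intervalIntegral.integral_interval_sub_left (ha.intervalIntegrable _ _)
      (ha.intervalIntegrable _ _)]

lemma prim_increment {a : ℝ → ℝ} (ha : LocBdd a) (θ t : ℝ) :
    prim (fun s => a (s + θ) - a s) t = prim a (t + θ) - prim a t - prim a θ := by
  rw [prim_sub (ha.comp_continuous (by fun_prop)) ha, prim_comp_add ha]
  ring

/-- The increments of the primitive of an asymptotically linear function are asymptotically
linear. -/
lemma tendsto_prim_increment_div {Y : ℝ → ℝ} {l : ℝ} (hY : LocBdd Y)
    (h : Tendsto (fun t => Y t / t) atTop (𝓝 l)) {θ : ℝ} (hθ : 0 ≤ θ) :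
    Tendsto (fun t => (prim Y (t + θ) - prim Y t) / t) atTop (𝓝 (l * θ)) := by
  obtain ⟨C, T, hC, hT, h1⟩ := exists_linear_bound_eventually h
  have heq : ∀ t, ∫ v in (0 : ℝ)..θ, Y (t + v) / t = (prim Y (t + θ) - prim Y t) / t := fun t => by
    rw [intervalIntegral.integral_div, intervalIntegral.integral_comp_add_left (fun s => Y s),
      add_zero, prim, prim, intervalIntegral.integral_interval_sub_left
        (hY.intervalIntegrable _ _) (hY.intervalIntegrable _ _)]
  have hl : l * θ = ∫ v in (0 : ℝ)..θ, l := by simp [mul_comm]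
  rw [hl]
  refine Tendsto.congr heq ?_
  refine intervalIntegral.tendsto_integral_filter_of_dominated_convergence
    (fun _ => C * (1 + θ)) ?_ ?_ (by simp) ?_
  · exact Eventually.of_forall fun t =>
      ((hY.measurable.comp (by fun_prop)).div_const t).aestronglyMeasurable
  · filter_upwards [eventually_ge_atTop T, eventually_ge_atTop 1] with t ht ht1
    refine Eventually.of_forall fun v hv => ?_
    rw [uIoc_of_le hθ] at hv
    rw [Real.norm_eq_abs, abs_div, abs_of_pos (by linarith : 0 < t), div_le_iff₀ (by linarith)]
    refine (h1 (t + v) (by linarith [hv.1])).trans ?_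
    rw [mul_assoc]
    refine mul_le_mul_of_nonneg_left ?_ hC
    nlinarith [hv.1, hv.2]
  · exact Eventually.of_forall fun v _ => tendsto_shift_div h v

/-- A function whose increments are asymptotically linear has small increments that are bounded by a
linear function, uniformly in the length of the increment: Baire's theorem applies to the closed
sets of lengths for which a given linear bound holds. -/
lemma exists_uniform_increment_bound {Φ : ℝ → ℝ} (hΦ : Continuous Φ)
    (h : ∀ θ ∈ Ioc (0 : ℝ) 1, ∃ L, Tendsto (fun t => (Φ (t + θ) - Φ t) / t) atTop (𝓝 L)) :
    ∃ δ ∈ Ioc (0 : ℝ) 1, ∃ C T : ℝ, 0 < T ∧ ∀ t, T ≤ t → ∀ v ∈ Icc 0 δ,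
      |Φ (t + v) - Φ t| ≤ C * t := by
  -- The lengths along which increments are asymptotically linear form a subgroup of `ℝ`.
  have hshift : ∀ {a b L : ℝ}, Tendsto (fun t => (Φ (t + b) - Φ t) / t) atTop (𝓝 L) →
      Tendsto (fun t => (Φ (t + a + b) - Φ (t + a)) / t) atTop (𝓝 L) := fun {a b L} hL =>
    tendsto_shift_div (Y := fun t => Φ (t + b) - Φ t) hL a
  let S : AddSubgroup ℝ :=
    { carrier := {θ | ∃ L, Tendsto (fun t => (Φ (t + θ) - Φ t) / t) atTop (𝓝 L)}
      zero_mem' := ⟨0, by simp⟩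
      add_mem' := by
        rintro a b ⟨L, hL⟩ ⟨M, hM⟩
        refine ⟨M + L, ((hshift (a := a) hM).add hL).congr fun t => ?_⟩
        rw [← add_assoc]
        ring
      neg_mem' := by
        rintro a ⟨L, hL⟩
        refine ⟨-L, (hshift (a := -a) hL).neg.congr fun t => ?_⟩
        rw [neg_add_cancel_right]
        ring }
  have hpos : ∀ θ : ℝ, 0 < θ → θ ∈ S := fun θ hθ => by
    obtain ⟨n, hn⟩ := exists_nat_gt θ
    have hn0 : (0 : ℝ) < n := hθ.trans hn
    have h1 : θ / n ∈ S := h (θ / n) ⟨by positivity, by rw [div_le_one hn0]; exact hn.le⟩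
    have h2 := S.nsmul_mem h1 n
    rwa [nsmul_eq_mul, mul_div_cancel₀ _ hn0.ne'] at h2
  have hall : ∀ θ : ℝ, θ ∈ S := fun θ => by
    rcases lt_trichotomy θ 0 with hθ | hθ | hθ
    · simpa using S.neg_mem (hpos (-θ) (by linarith))
    · rw [hθ]; exact S.zero_mem
    · exact hpos θ hθ
  let A : ℕ → Set ℝ := fun n => {θ | ∀ t : ℝ, (n : ℝ) + 1 ≤ t → |Φ (t + θ) - Φ t| ≤ (n + 1) * t}
  have hAc : ∀ n, IsClosed (A n) := fun n => by
    simp only [A, ofPred_forall]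
    exact isClosed_iInter fun t => isClosed_iInter fun _ =>
      isClosed_le (by fun_prop) continuous_const
  have hAu : ⋃ n, A n = univ := by
    refine eq_univ_of_forall fun θ => mem_iUnion.mpr ?_
    obtain ⟨L, hL⟩ := hall θ
    obtain ⟨C, T, hC, hT, hb⟩ :=
      exists_linear_bound_eventually (Y := fun t => Φ (t + θ) - Φ t) hL
    obtain ⟨n, hn⟩ := exists_nat_gt (max C T)
    refine ⟨n, fun t ht => (hb t ?_).trans ?_⟩
    · linarith [le_max_right C T]
    · exact mul_le_mul_of_nonneg_right (by linarith [le_max_left C T])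
        (by linarith [le_max_right C T])
  obtain ⟨N, a, ha⟩ := nonempty_interior_of_iUnion_of_closed hAc hAu
  obtain ⟨ε, hε, hball⟩ := Metric.isOpen_iff.mp isOpen_interior a ha
  have hball' : ∀ v : ℝ, |v| < ε → a + v ∈ A N := fun v hv =>
    interior_subset (hball (by simpa [Metric.mem_ball, Real.dist_eq] using hv))
  refine ⟨min (ε / 2) 1, ⟨by positivity, min_le_right _ _⟩, 2 * (N + 1) * (1 + |a|),
    N + 1 + |a|, by positivity, fun t ht v hv => ?_⟩
  have hv' : |v| < ε := by
    rw [abs_of_nonneg hv.1]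
    linarith [hv.2, min_le_left (ε / 2) 1]
  have hN : (0 : ℝ) ≤ N := Nat.cast_nonneg N
  have hs : (N : ℝ) + 1 ≤ t - a := by linarith [le_abs_self a]
  have h1 := hball' v hv' (t - a) hs
  have h2 := hball' 0 (by simpa using hε) (t - a) hs
  rw [show t - a + (a + v) = t + v by ring] at h1
  rw [show t - a + (a + 0) = t by ring] at h2
  have h3 : t - a ≤ (1 + |a|) * t := by nlinarith [neg_abs_le a, abs_nonneg a]
  have h4 : |Φ (t + v) - Φ t| ≤ 2 * (N + 1) * (t - a) := by
    calc |Φ (t + v) - Φ t| = |(Φ (t + v) - Φ (t - a)) - (Φ t - Φ (t - a))| := by congr 1; ring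
      _ ≤ (N + 1) * (t - a) + (N + 1) * (t - a) := (abs_sub _ _).trans (add_le_add h1 h2)
      _ = 2 * (N + 1) * (t - a) := by ring
  rw [mul_assoc]
  exact h4.trans (mul_le_mul_of_nonneg_left h3 (by positivity))

/-- The uniform bound on small increments allows dominated convergence for their average. -/
lemma exists_tendsto_integral_increment {Φ : ℝ → ℝ} (hΦ : Continuous Φ)
    (h : ∀ θ ∈ Ioc (0 : ℝ) 1, ∃ L, Tendsto (fun t => (Φ (t + θ) - Φ t) / t) atTop (𝓝 L)) :
    ∃ δ ∈ Ioc (0 : ℝ) 1, ∃ q,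
      Tendsto (fun t => (∫ v in (0 : ℝ)..δ, (Φ (t + v) - Φ t)) / t) atTop (𝓝 q) := by
  obtain ⟨δ, hδ, C, T, hT, hb⟩ := exists_uniform_increment_bound hΦ h
  choose! L hL using h
  refine ⟨δ, hδ, ∫ v in (0 : ℝ)..δ, L v, ?_⟩
  simp only [← intervalIntegral.integral_div]
  refine intervalIntegral.tendsto_integral_filter_of_dominated_convergence
    (fun _ => C) ?_ ?_ (by simp) ?_
  · exact Eventually.of_forall fun t => Continuous.aestronglyMeasurable (by fun_prop)
  · filter_upwards [eventually_ge_atTop T] with t ht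
    refine Eventually.of_forall fun v hv => ?_
    rw [uIoc_of_le hδ.1.le] at hv
    have ht0 : 0 < t := hT.trans_le ht
    rw [Real.norm_eq_abs, abs_div, abs_of_pos ht0, div_le_iff₀ ht0]
    exact hb t ht v ⟨hv.1.le, hv.2⟩
  · refine Eventually.of_forall fun v hv => ?_
    rw [uIoc_of_le hδ.1.le] at hv
    exact hL v ⟨hv.1, hv.2.trans hδ.2⟩

/-- The integrated form of the forced delay equation, for a continuous function `y` on `ℝ`. -/
structure PolarMeasure.IsSol {τ : ℝ} (ν : PolarMeasure τ) (f y : ℝ → ℝ) : Prop where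
  cont : Continuous y
  int : ∀ a b, IntervalIntegrable f volume a b
  eq : ∀ t, 0 ≤ t → y t = y 0 + prim (ν.delay y) t + prim f t

namespace PolarMeasure.IsSol

variable {τ : ℝ} {ν : PolarMeasure τ} {f y : ℝ → ℝ}

lemma locBdd (h : ν.IsSol f y) : LocBdd y := LocBdd.of_continuous h.cont

lemma eq_delay_prim (h : ν.IsSol f y) {t : ℝ} (ht : 0 ≤ t) :
    y t = ν.delay (prim y) t + (prim f t + (y 0 - ν.delay (prim y) 0)) := by
  rw [h.eq t ht, ν.prim_delay h.locBdd]
  ring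

lemma locBdd_prim (h : ν.IsSol f y) : LocBdd (prim f) :=
  LocBdd.of_continuous (continuous_prim h.int)

lemma intervalAvg_eq (h : ν.IsSol f y) (θ t : ℝ) :
    intervalAvg f θ t = prim f (t + θ) - prim f t := by
  rw [intervalAvg, prim, prim, intervalIntegral.integral_interval_sub_left (h.int _ _) (h.int _ _)]

lemma prim_intervalAvg (h : ν.IsSol f y) (θ t : ℝ) :
    prim (intervalAvg f θ) t
      = prim (prim f) (t + θ) - prim (prim f) t - prim (prim f) θ := by
  rw [funext (h.intervalAvg_eq θ), prim_increment h.locBdd_prim]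

lemma tendsto_increment_of_intervalAvg (h : ν.IsSol f y) {θ L : ℝ}
    (hL : Tendsto (fun t => prim (intervalAvg f θ) t / t) atTop (𝓝 L)) :
    Tendsto (fun t => (prim (prim f) (t + θ) - prim (prim f) t) / t) atTop (𝓝 L) := by
  have := hL.add (tendsto_const_div_atTop (prim (prim f) θ))
  rw [add_zero] at this
  refine this.congr fun t => ?_
  rw [h.prim_intervalAvg]
  ring

/-- The Cesàro limit of the solution determines those of the interval averages of the forcing. -/
lemma tendsto_prim_intervalAvg_div (h : ν.IsSol f y) {l : ℝ}
    (hl : Tendsto (fun t => prim y t / t) atTop (𝓝 l)) {θ : ℝ} (hθ : 0 ≤ θ) :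
    Tendsto (fun t => prim (intervalAvg f θ) t / t) atTop (𝓝 (-(l * ν.mass) * θ)) := by
  set X := prim y with hX
  have hXL : LocBdd X := h.locBdd.prim
  set W : ℝ → ℝ := fun t => X (t + θ) - X t with hW
  have hXθ : LocBdd fun t => X (t + θ) := hXL.comp_continuous (by fun_prop)
  have hWL : LocBdd W := LocBdd.of_continuous (by
    have : Continuous X := h.locBdd.continuous_prim
    fun_prop)
  have hWd : ∀ s, ν.delay X (s + θ) - ν.delay X s = ν.delay W s := fun s => by
    rw [hW, ν.delay_sub hXθ hXL]
    simp only [delay, add_right_comm]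
  have hp : ∀ t, 0 ≤ t → prim (intervalAvg f θ) t
      = W t - X θ - (ν.delay (prim W) t - ν.delay (prim W) 0) := fun t ht => by
    have h1 : prim (intervalAvg f θ) t
        = prim (fun s => (y (s + θ) - y s) - ν.delay W s) t := by
      refine prim_congr (fun s hs => ?_) ht
      rw [h.intervalAvg_eq, ← hWd]
      have e1 := h.eq_delay_prim (by linarith : 0 ≤ s + θ)
      have e2 := h.eq_delay_prim hs.le
      linarith
    rw [h1, prim_sub (LocBdd.of_continuous (by have := h.cont; fun_prop)) (ν.locBdd_delay hWL),
      prim_increment h.locBdd, ν.prim_delay hWL]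
  have t1 : Tendsto (fun t => X (t + θ) / t - X t / t) atTop (𝓝 (l - l)) :=
    (tendsto_shift_div hl θ).sub hl
  have t2 : Tendsto (fun t => prim W t / t) atTop (𝓝 (l * θ)) := by
    have := (tendsto_prim_increment_div hXL hl hθ).sub (tendsto_const_div_atTop (prim X θ))
    rw [sub_zero] at this
    refine this.congr fun t => ?_
    rw [hW, prim_increment hXL]
    ring
  have t3 := ν.tendsto_delay_div hWL.prim t2
  have t4 := (t1.sub t3).add (tendsto_const_div_atTop (ν.delay (prim W) 0 - X θ))
  have e : -(l * ν.mass) * θ = l - l - l * θ * ν.mass + 0 := by ring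
  rw [e]
  refine t4.congr' ?_
  filter_upwards [eventually_ge_atTop 0] with t ht
  rw [hp t ht]
  simp only [hW]
  ring

variable {r : ℝ → ℝ}

/-- Convergence of the Cesàro means of all short interval averages of the forcing is enough for
the Cesàro means of the solution to converge: after subtracting the deviation of `∫∫f` from its
running average, which is asymptotically linear, the forcing becomes asymptotically linear. -/
lemma exists_tendsto_prim_div (h : ν.IsSol f y) (hr : ν.IsRes r) (hi : IntegrableOn r (Ioi 0))
    (hf : ∀ θ ∈ Ioc (0 : ℝ) 1, ∃ L,
      Tendsto (fun t => prim (intervalAvg f θ) t / t) atTop (𝓝 L)) :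
    ∃ l, Tendsto (fun t => prim y t / t) atTop (𝓝 l) := by
  set F := prim f with hF
  have hFc : Continuous F := continuous_prim h.int
  have hFL : LocBdd F := h.locBdd_prim
  set Φ := prim F with hΦ
  have hΦc : Continuous Φ := hFL.continuous_prim
  have hΦL : LocBdd Φ := hFL.prim
  have hinc : ∀ θ ∈ Ioc (0 : ℝ) 1, ∃ L, Tendsto (fun t => (Φ (t + θ) - Φ t) / t) atTop (𝓝 L) :=
    fun θ hθ => (hf θ hθ).imp fun L hL => h.tendsto_increment_of_intervalAvg hL
  obtain ⟨δ, hδ, q, hq⟩ := exists_tendsto_integral_increment hΦc hinc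
  obtain ⟨L, hL⟩ := hinc δ hδ
  have hδ0 : δ ≠ 0 := hδ.1.ne'
  -- `p = F - A` is the derivative of `Φ(t) - (1/δ) ∫_t^{t+δ} Φ`, which is asymptotically linear.
  -- Replacing `y` by `y - p` replaces the forcing `F` by `A + ν.delay (prim p)`.
  set A : ℝ → ℝ := fun t => δ⁻¹ * (Φ (t + δ) - Φ t) with hA
  have hAc : Continuous A := by fun_prop
  set p : ℝ → ℝ := fun t => F t - A t with hp
  have hpL : LocBdd p := LocBdd.of_continuous (by fun_prop)
  have hpq : Tendsto (fun t => prim p t / t) atTop (𝓝 (-(δ⁻¹ * q) + 0)) := by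
    refine ((hq.const_mul δ⁻¹).neg.add (tendsto_const_div_atTop (δ⁻¹ * prim Φ δ))).congr
      fun t => ?_
    have e1 : ∫ v in (0 : ℝ)..δ, (Φ (t + v) - Φ t) = prim Φ (t + δ) - prim Φ t - δ * Φ t := by
      rw [intervalIntegral.integral_sub ((hΦL.comp_continuous (by fun_prop)).intervalIntegrable _ _)
        (by simp), intervalIntegral.integral_comp_add_left (fun s => Φ s), add_zero,
        prim, prim, intervalIntegral.integral_interval_sub_left
        (hΦL.intervalIntegrable _ _) (hΦL.intervalIntegrable _ _)]
      simp
    rw [e1, hp, prim_sub hFL (LocBdd.of_continuous hAc), hA, prim_const_mul, prim_increment hΦL]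
    field_simp
    ring
  set z : ℝ → ℝ := fun t => y t - p t with hz
  have hzc : Continuous z := by have := h.cont; fun_prop
  have hzp : ∀ t, prim z t = prim y t - prim p t := fun t => prim_sub h.locBdd hpL t
  set G : ℝ → ℝ := fun t => ν.delay (prim p) t + A t + (y 0 - ν.delay (prim y) 0) with hG
  have hGc : Continuous G := by
    have := ν.continuous_delay hpL.continuous_prim
    fun_prop
  have hGt := ((ν.tendsto_delay_div hpL.prim hpq).add (hL.const_mul δ⁻¹)).add
    (tendsto_const_div_atTop (y 0 - ν.delay (prim y) 0))
  have hml := hr.tendsto_prim_div hi (LocBdd.of_continuous hzc) (LocBdd.of_continuous hGc)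
    (fun t ht => by
      rw [funext hzp, ν.delay_sub h.locBdd.prim hpL.prim]
      simp only [hz, hG]
      rw [h.eq_delay_prim ht]
      simp only [hp]
      ring)
    (hGt.congr fun t => by
      simp only [hG, hA]
      ring)
  refine ⟨_, (hml.add hpq).congr fun t => ?_⟩
  rw [hzp]
  ring

/-- A forcing with Cesàro limit `L` gives a solution with Cesàro limit `-L / mass`. -/
lemma tendsto_prim_div (h : ν.IsSol f y) (hr : ν.IsRes r) (hi : IntegrableOn r (Ioi 0)) {L : ℝ}
    (hf : Tendsto (fun t => prim f t / t) atTop (𝓝 L)) :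
    Tendsto (fun t => prim y t / t) atTop (𝓝 (-L / ν.mass)) := by
  refine hr.tendsto_prim_div hi h.locBdd
    (LocBdd.of_continuous ((continuous_prim h.int).add continuous_const))
    (fun t ht => h.eq_delay_prim ht) ?_
  have := hf.add (tendsto_const_div_atTop (y 0 - ν.delay (prim y) 0))
  rw [add_zero] at this
  refine this.congr fun t => ?_
  simp only [Pi.add_apply]
  ring

/-- The integrated equation relates the asymptotic slopes of `y`, of `∫ f` and of `∫ y`. -/
lemma tendsto_div_sub (h : ν.IsSol f y) {l : ℝ}
    (hl : Tendsto (fun t => prim y t / t) atTop (𝓝 l)) :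
    Tendsto (fun t => (y t - prim f t) / t) atTop (𝓝 (l * ν.mass)) := by
  have := (ν.tendsto_delay_div h.locBdd.prim hl).add
    (tendsto_const_div_atTop (y 0 - ν.delay (prim y) 0))
  rw [add_zero] at this
  refine this.congr' ?_
  filter_upwards [eventually_ge_atTop 0] with t ht
  rw [h.eq_delay_prim ht]
  ring

end PolarMeasure.IsSol

end

/-! ### From the differential equation to the integrated equation -/

section

lemma mem_L1loc_iff {g : ℝ → ℝ} :
    g ∈ L1loc ↔ ∀ T, 0 ≤ T → IntervalIntegrable g volume 0 T := by
  rw [L1loc, mem_ofPred_eq, locallyIntegrableOn_iff isClosed_Ici.isLocallyClosed]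
  constructor
  · intro h T hT
    rw [intervalIntegrable_iff_integrableOn_Icc_of_le hT]
    exact h _ Icc_subset_Ici_self isCompact_Icc
  · intro h k hk hkc
    obtain ⟨T, hT⟩ := hkc.bddAbove
    have h1 := h (max T 0) (le_max_right _ _)
    rw [intervalIntegrable_iff_integrableOn_Icc_of_le (le_max_right _ _)] at h1
    exact h1.mono_set fun x hx => ⟨hk hx, (hT hx).trans (le_max_left _ _)⟩

/-- Membership in `L1loc` depends only on the values almost everywhere on `(0, ∞)`. -/
lemma mem_L1loc_congr {g h : ℝ → ℝ} (hgh : ∀ᵐ t : ℝ, 0 < t → g t = h t) :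
    g ∈ L1loc ↔ h ∈ L1loc := by
  simp only [mem_L1loc_iff]
  refine forall₂_congr fun T hT => ?_
  refine intervalIntegrable_congr_ae ?_
  rw [uIoc_of_le hT]
  refine (ae_restrict_iff' measurableSet_Ioc).mpr ?_
  filter_upwards [hgh] with t ht ht'
  exact ht ht'.1

lemma LocBdd.mem_L1loc {g : ℝ → ℝ} (hg : LocBdd g) : g ∈ L1loc :=
  mem_L1loc_iff.mpr fun _ _ => hg.intervalIntegrable _ _

lemma hasCesaroLimit_iff {g : ℝ → ℝ} {L : ℝ} :
    HasCesaroLimit g L ↔ Tendsto (fun t => prim g t / t) atTop (𝓝 L) := by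
  have : (fun t : ℝ => (1 / t) * ∫ s in (0 : ℝ)..t, g s) = fun t => prim g t / t := by
    funext t
    rw [prim]
    ring
  rw [HasCesaroLimit, this]

lemma prim_congr_ae {g h : ℝ → ℝ} (hgh : ∀ᵐ t : ℝ, 0 < t → g t = h t) {t : ℝ} (ht : 0 ≤ t) :
    prim g t = prim h t := by
  refine intervalIntegral.integral_congr_ae ?_
  filter_upwards [hgh] with s hs hs'
  rw [uIoc_of_le ht] at hs'
  exact hs hs'.1

lemma hasCesaroLimit_congr {g h : ℝ → ℝ} (hgh : ∀ᵐ t : ℝ, 0 < t → g t = h t) {L : ℝ} :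
    HasCesaroLimit g L ↔ HasCesaroLimit h L := by
  rw [hasCesaroLimit_iff, hasCesaroLimit_iff]
  refine tendsto_congr' ?_
  filter_upwards [eventually_ge_atTop 0] with t ht
  rw [prim_congr_ae hgh ht]

lemma mem_Ces_congr {g h : ℝ → ℝ} (hgh : ∀ᵐ t : ℝ, 0 < t → g t = h t) :
    g ∈ Ces ↔ h ∈ Ces :=
  and_congr (mem_L1loc_congr hgh) (exists_congr fun _ => hasCesaroLimit_congr hgh)

lemma intervalIntegrable_indicator {f : ℝ → ℝ} (hf : f ∈ L1loc) (a b : ℝ) :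
    IntervalIntegrable ((Ici (0 : ℝ)).indicator f) volume a b := by
  have h1 := (mem_L1loc_iff.mp hf) (max (max a b) 0) (le_max_right _ _)
  rw [intervalIntegrable_iff_integrableOn_Icc_of_le (le_max_right _ _)] at h1
  rw [intervalIntegrable_iff, IntegrableOn, integrable_indicator_iff measurableSet_Ici,
    IntegrableOn, Measure.restrict_restrict measurableSet_Ici]
  refine h1.mono_set fun x hx => ⟨hx.1, ?_⟩
  have := hx.2.2
  exact this.trans (le_max_left _ _)

lemma intervalAvg_indicator (f : ℝ → ℝ) {θ t : ℝ} (hθ : 0 ≤ θ) (ht : 0 < t) :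
    intervalAvg f θ t = intervalAvg ((Ici (0 : ℝ)).indicator f) θ t := by
  refine intervalIntegral.integral_congr_ae (Eventually.of_forall fun s hs => ?_)
  rw [uIoc_of_le (by linarith)] at hs
  rw [indicator_of_mem (mem_Ici.mpr (ht.trans hs.1).le)]

variable {τ : ℝ} {μ : SignedMeasure (Icc (-τ) 0)} {ν : PolarMeasure τ}

lemma PolarMeasure.Represents.integral_eq_delay (hν : ν.Represents μ) {x y : ℝ → ℝ}
    (hy : LocBdd y) (hxy : ∀ t, -τ ≤ t → y t = x t) {t : ℝ} (ht : 0 ≤ t) :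
    ∫ᵛ u : Icc (-τ) 0, x (t + u) ∂•μ = ν.delay y t := by
  have : (fun u : Icc (-τ) 0 => x (t + u)) = fun u : Icc (-τ) 0 => y (t + u) := by
    funext u
    exact (hxy _ (by linarith [u.2.1])).symm
  rw [this]
  obtain ⟨C, -, hC⟩ := PolarMeasure.exists_bound_shift (τ := τ) hy |t|
  exact hν _ C (PolarMeasure.measurable_shift hy.measurable t) (hC t le_rfl)

lemma SolvesDelayEq.deriv_eq {f x y : ℝ → ℝ} (hx : SolvesDelayEq μ f x) (hν : ν.Represents μ)
    (hy : LocBdd y) (hxy : ∀ t, -τ ≤ t → y t = x t) :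
    ∀ᵐ t : ℝ, 0 < t → deriv x t = ν.delay y t + f t := by
  filter_upwards [hx.2] with t ht ht0
  rw [(ht ht0).deriv, hν.integral_eq_delay hy hxy ht0.le]

lemma SolvesDelayEq.prim_deriv {f x : ℝ → ℝ} (hx : SolvesDelayEq μ f x) {t : ℝ} (ht : 0 ≤ t) :
    prim (deriv x) t = x t - x 0 := by
  rcases ht.eq_or_lt with rfl | ht
  · simp [prim]
  · exact (hx.1 t ht).integral_deriv_eq_sub

lemma SolvesDelayEq.deriv_mem_L1loc {f x : ℝ → ℝ} (hx : SolvesDelayEq μ f x) :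
    deriv x ∈ L1loc :=
  mem_L1loc_iff.mpr fun T hT => by
    rcases hT.eq_or_lt with rfl | hT
    · simp
    · exact (hx.1 T hT).intervalIntegrable_deriv

lemma SolvesDelayEq.eq_prim {f x y : ℝ → ℝ} (hx : SolvesDelayEq μ f x) (hν : ν.Represents μ)
    (hf : f ∈ L1loc) (hy : LocBdd y) (hxy : ∀ t, -τ ≤ t → y t = x t) {t : ℝ} (ht : 0 ≤ t) :
    x t = x 0 + prim (ν.delay y) t + prim f t := by
  have h1 : prim (deriv x) t = prim (ν.delay y) t + prim f t := by
    rw [prim_congr_ae (hx.deriv_eq hν hy hxy) ht]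
    exact intervalIntegral.integral_add ((ν.locBdd_delay hy).intervalIntegrable 0 t)
      (mem_L1loc_iff.mp hf t ht)
  rw [hx.prim_deriv ht] at h1
  linarith

lemma SolvesDelayEq.continuousOn {f x : ℝ → ℝ} (hx : SolvesDelayEq μ f x) :
    ContinuousOn x (Ici 0) := by
  intro t ht
  have ht0 : (0 : ℝ) ≤ t := ht
  have h1 := (hx.1 (t + 1) (by linarith)).continuousOn
  rw [uIcc_of_le (by linarith)] at h1
  refine (h1 t ⟨ht0, by linarith⟩).mono_of_mem_nhdsWithin ?_
  rw [← Ici_inter_Iic]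
  exact inter_mem self_mem_nhdsWithin (mem_nhdsWithin_of_mem_nhds (Iic_mem_nhds (by linarith)))

lemma IsResolvent.isRes {r : ℝ → ℝ} (hr : IsResolvent μ r) (hν : ν.Represents μ) : ν.IsRes r := by
  have hc : Continuous fun t => r (max t 0) :=
    hr.1.continuousOn.comp_continuous (by fun_prop) fun t => mem_Ici.mpr (le_max_right _ _)
  have hind : (Ici (0 : ℝ)).indicator (fun t => r (max t 0)) = r := by
    funext t
    rcases lt_or_ge t 0 with ht | ht
    · rw [indicator_of_notMem (by simpa using ht), hr.2.2 t ht]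
    · rw [indicator_of_mem (mem_Ici.mpr ht), max_eq_left ht]
  have hL : LocBdd r := by
    rw [← hind]
    exact (LocBdd.of_continuous hc).indicator_Ici
  refine ⟨hL, hr.2.2, fun t ht => ?_⟩
  have h0 : (0 : ℝ → ℝ) ∈ L1loc := (LocBdd.of_continuous continuous_zero).mem_L1loc
  rw [hr.1.eq_prim hν h0 hL (fun _ _ => rfl) ht, hr.2.1]
  simp [prim]

/-- A solution agrees on `[-τ, ∞)` with a continuous function on `ℝ` that satisfies the integrated
equation; the values of the solution to the left of `-τ` are irrelevant. -/
lemma IsSolution.exists_isSol {f x : ℝ → ℝ} {ψ : C(Icc (-τ) 0, ℝ)} (hτ : 0 < τ)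
    (hx : IsSolution μ f ψ x) (hν : ν.Represents μ) (hf : f ∈ L1loc) :
    ∃ y, ν.IsSol ((Ici (0 : ℝ)).indicator f) y ∧ ∀ t, -τ ≤ t → y t = x t := by
  have h1 : ContinuousOn x (Icc (-τ) 0) := by
    rw [continuousOn_iff_continuous_domRestrict]
    have : (Icc (-τ) 0).domRestrict x = ψ := funext fun s => hx.2 s
    rw [this]
    exact ψ.continuous
  have h2 : ContinuousOn x (Ici (-τ)) := by
    rw [← Icc_union_Ici_eq_Ici (by linarith : -τ ≤ 0)]
    exact h1.union_of_isClosed hx.1.continuousOn isClosed_Icc isClosed_Ici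
  have hc : Continuous fun t => x (max t (-τ)) :=
    h2.comp_continuous (by fun_prop) fun t => mem_Ici.mpr (le_max_right _ _)
  have hxy : ∀ t, -τ ≤ t → x (max t (-τ)) = x t := fun t ht => by rw [max_eq_left ht]
  refine ⟨fun t => x (max t (-τ)), ⟨hc, intervalIntegrable_indicator hf, fun t ht => ?_⟩, hxy⟩
  simp only [hxy t (by linarith), hxy 0 (by linarith), prim_indicator f ht]
  exact hx.1.eq_prim hν hf (LocBdd.of_continuous hc) hxy ht

end

/-! ### Integrability of the resolvent from Cesàro convergence of solutions -/

section

open scoped ZeroAtInfty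

/-- The uniform boundedness principle for weighted means of a convolution.  If for every `g`
vanishing at infinity the convolution of `y` with `s ↦ s⁺ g(s)` grows at most linearly along the
integers, then the integrals of `|y|` over `[0, T]` are bounded. -/
lemma exists_integral_abs_bound {y : ℝ → ℝ} (hy : Continuous y) (hy0 : ∀ s, s ≤ 0 → y s = 0)
    (h : ∀ g : C₀(ℝ, ℝ), ∃ C, ∀ n : ℕ, |conv y (fun s => max s 0 * g s) n / n| ≤ C) :
    ∃ M, ∀ T, 0 ≤ T → ∫ s in (0 : ℝ)..T, |y s| ≤ M := by
  let w : ℕ → ℝ → ℝ := fun n s => y (n - s) * max s 0 / n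
  have hw : ∀ n, Continuous (w n) := fun n => by fun_prop
  have hint : ∀ (n : ℕ) (g : C₀(ℝ, ℝ)), IntervalIntegrable (fun s => w n s * g s) volume 0 n :=
    fun n g => ((hw n).mul g.continuous).intervalIntegrable _ _
  have hnorm : ∀ (g : C₀(ℝ, ℝ)) (s : ℝ), |g s| ≤ ‖g‖ := fun g s =>
    g.toBCF.norm_coe_le_norm s
  have hbd : ∀ (n : ℕ) (g : C₀(ℝ, ℝ)),
      ‖∫ s in (0 : ℝ)..n, w n s * g s‖ ≤ (∫ s in (0 : ℝ)..n, |w n s|) * ‖g‖ := fun n g => by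
    rw [← intervalIntegral.integral_mul_const]
    refine intervalIntegral.norm_integral_le_of_norm_le (Nat.cast_nonneg n)
      (Eventually.of_forall fun s _ => ?_) (((hw n).abs.mul continuous_const).intervalIntegrable _ _)
    rw [Real.norm_eq_abs, abs_mul]
    exact mul_le_mul_of_nonneg_left (hnorm g s) (abs_nonneg _)
  let Λ : ℕ → C₀(ℝ, ℝ) →L[ℝ] ℝ := fun n => LinearMap.mkContinuous
    { toFun := fun g => ∫ s in (0 : ℝ)..n, w n s * g s
      map_add' := fun g g' => by
        simp only [ZeroAtInftyContinuousMap.add_apply, mul_add]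
        exact intervalIntegral.integral_add (hint n g) (hint n g')
      map_smul' := fun c g => by
        simp only [ZeroAtInftyContinuousMap.smul_apply, smul_eq_mul, RingHom.id_apply,
          mul_left_comm _ c]
        exact intervalIntegral.integral_const_mul _ _ } _ (hbd n)
  have hΛ : ∀ n g, Λ n g = ∫ s in (0 : ℝ)..n, w n s * g s := fun n g => rfl
  have hpt : ∀ g, ∃ C, ∀ n, ‖Λ n g‖ ≤ C := fun g => by
    obtain ⟨C, hC⟩ := h g
    refine ⟨C, fun n => ?_⟩
    have : Λ n g = conv y (fun s => max s 0 * g s) n / n := by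
      rw [hΛ, conv, ← intervalIntegral.integral_div]
      congr 1
      funext s
      simp only [w]
      ring
    rw [this]
    exact hC n
  obtain ⟨C, hC⟩ := banach_steinhaus hpt
  -- Testing against a regularised sign of the kernel bounds its `L¹` norm.
  have hL1 : ∀ n : ℕ, ∫ s in (0 : ℝ)..n, |w n s| ≤ C + 1 := fun n => by
    have hε : (0 : ℝ) < 1 / (n + 1) := by positivity
    set ε : ℝ := 1 / (n + 1) with hεdef
    have hden : ∀ s, 0 < |w n s| + ε := fun s => by positivity
    have hgc : Continuous fun s => w n s / (|w n s| + ε) :=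
      (hw n).div ((hw n).abs.add continuous_const) fun s => (hden s).ne'
    have hsupp : HasCompactSupport fun s => w n s / (|w n s| + ε) := by
      refine HasCompactSupport.intro (isCompact_Icc (a := (0 : ℝ)) (b := n)) fun s hs => ?_
      have : w n s = 0 := by
        rcases lt_or_ge s 0 with h1 | h1
        · simp [w, max_eq_right h1.le]
        · have h2 : (n : ℝ) < s := by
            by_contra h3
            exact hs ⟨h1, not_lt.mp h3⟩
          simp [w, hy0 (n - s) (by linarith)]
      rw [this, zero_div]
    let g : C₀(ℝ, ℝ) := ⟨⟨_, hgc⟩, hsupp.is_zero_at_infty⟩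
    have hg : ∀ s, g s = w n s / (|w n s| + ε) := fun s => rfl
    have hg1 : ‖g‖ ≤ 1 := by
      refine (BoundedContinuousFunction.norm_le (f := g.toBCF) zero_le_one).mpr fun s => ?_
      change ‖w n s / (|w n s| + ε)‖ ≤ 1
      rw [Real.norm_eq_abs, abs_div, abs_of_pos (hden s), div_le_one (hden s)]
      linarith
    have h1 : Λ n g ≤ C := (le_abs_self _).trans
      (((Λ n).le_of_opNorm_le (hC n) g).trans (mul_le_of_le_one_right
        ((norm_nonneg _).trans (hC n)) hg1))
    have h2 : ∫ s in (0 : ℝ)..n, (|w n s| - ε) ≤ Λ n g := by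
      rw [hΛ]
      refine intervalIntegral.integral_mono (Nat.cast_nonneg n)
        (((hw n).abs.sub continuous_const).intervalIntegrable _ _) (hint n g) fun s => ?_
      simp only [hg]
      rw [mul_div_assoc', le_div_iff₀ (hden s)]
      nlinarith [sq_abs (w n s), sq_nonneg ε]
    rw [intervalIntegral.integral_sub ((hw n).abs.intervalIntegrable _ _) (by simp)] at h2
    have h3 : ∫ s in (0 : ℝ)..n, ε ≤ 1 := by
      rw [intervalIntegral.integral_const, smul_eq_mul, sub_zero, hεdef, mul_one_div,
        div_le_one (by positivity)]
      linarith
    linarith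
  refine ⟨2 * (C + 1), fun T hT => ?_⟩
  -- On `[0, T]` the weight `(n - s) / n` is at least `1 / 2` as soon as `n ≥ 2 T`.
  obtain ⟨n, hn⟩ := exists_nat_gt (2 * T + 1)
  have hn0 : (0 : ℝ) < n := by linarith
  have hc1 : Continuous fun s => |y s| * max (n - s) 0 / n := by fun_prop
  have h1 : ∫ s in (0 : ℝ)..n, |w n s| = ∫ s in (0 : ℝ)..n, |y s| * max (n - s) 0 / n := by
    have := intervalIntegral.integral_comp_sub_left (a := 0) (b := (n : ℝ))
      (fun s => |y s| * max (n - s) 0 / n) n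
    simp only [sub_sub_cancel, sub_self, sub_zero] at this
    rw [← this]
    congr 1
    funext s
    simp only [w]
    rw [abs_div, abs_mul, abs_of_nonneg (le_max_right s 0), abs_of_pos hn0]
  have h2 : ∫ s in (0 : ℝ)..T, |y s| / 2 ≤ ∫ s in (0 : ℝ)..T, |y s| * max (n - s) 0 / n := by
    refine intervalIntegral.integral_mono_on hT ((hy.abs.div_const 2).intervalIntegrable _ _)
      (hc1.intervalIntegrable _ _) fun s hs => ?_
    rw [mul_div_assoc, div_eq_mul_one_div]
    refine mul_le_mul_of_nonneg_left ?_ (abs_nonneg _)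
    rw [le_div_iff₀ hn0]
    exact le_trans (by linarith [hs.2]) (le_max_left _ _)
  have h3 : ∫ s in (0 : ℝ)..T, |y s| * max (n - s) 0 / n
      ≤ ∫ s in (0 : ℝ)..n, |y s| * max (n - s) 0 / n := by
    refine intervalIntegral.integral_mono_interval le_rfl hT (by linarith)
      (Eventually.of_forall fun s => ?_) (hc1.intervalIntegrable _ _)
    change 0 ≤ |y s| * max (n - s) 0 / n
    positivity
  rw [intervalIntegral.integral_div] at h2
  have := hL1 n
  linarith

lemma prim_mono_of_nonneg {a : ℝ → ℝ} (ha : LocBdd a) (h0 : ∀ s, 0 ≤ a s) {s t : ℝ}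
    (hst : s ≤ t) : prim a s ≤ prim a t := by
  have : prim a t - prim a s = ∫ w in s..t, a w :=
    intervalIntegral.integral_interval_sub_left (ha.intervalIntegrable _ _)
      (ha.intervalIntegrable _ _)
  have h2 : 0 ≤ ∫ w in s..t, a w := intervalIntegral.integral_nonneg hst fun w _ => h0 w
  linarith

lemma LocBdd.abs {a : ℝ → ℝ} (ha : LocBdd a) : LocBdd fun s => |a s| :=
  ⟨ha.measurable.abs, fun T => by simpa using ha.bounded T⟩

variable {τ : ℝ} {μ : SignedMeasure (Icc (-τ) 0)} {ν : PolarMeasure τ} {r : ℝ → ℝ}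

/-- The underlying positive measure, as a polar measure with density `1`. -/
def PolarMeasure.abs (ν : PolarMeasure τ) : PolarMeasure τ :=
  ⟨ν.m, fun _ => 1, ν.finite, measurable_const, by simp⟩

lemma PolarMeasure.abs_delay_le (ν : PolarMeasure τ) {a : ℝ → ℝ} (ha : LocBdd a) (t : ℝ) :
    |ν.delay a t| ≤ ν.abs.delay (fun s => |a s|) t := by
  obtain ⟨C, -, hC⟩ := exists_bound_shift (τ := τ) ha |t|
  change ‖∫ u, ν.σ u * a (t + u) ∂ν.m‖ ≤ _
  refine norm_integral_le_of_norm_le (ν.abs.integrable_int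
    (measurable_shift ha.abs.measurable t) (C := C) fun u => by
      rw [abs_abs]; exact hC t le_rfl u) (Eventually.of_forall fun u => ?_)
  rw [Real.norm_eq_abs, abs_mul]
  exact mul_le_mul_of_nonneg_right (ν.le_one u) (abs_nonneg _)

/-- The mean of `r` over `[t - h, t]`. -/
def backwardMean (r : ℝ → ℝ) (h t : ℝ) : ℝ := h⁻¹ * (prim r t - prim r (t - h))

namespace PolarMeasure.IsRes

lemma delay_neg (h : ν.IsRes r) {t : ℝ} (ht : t < 0) : ν.delay r t = 0 := by
  have : (fun u : Icc (-τ) 0 => r (t + u)) = fun _ => 0 :=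
    funext fun u => h.neg _ (by linarith [u.2.2])
  rw [delay, this, ν.int_const, zero_mul]

/-- The delay operator is bounded by the total mass of `ν.m` on `L¹(0, T)`, for functions vanishing
on the negative half-line. -/
lemma prim_abs_delay_le (h : ν.IsRes r) {T : ℝ} (hT : 0 ≤ T) :
    prim (fun s => |ν.delay r s|) T ≤ prim (fun s => |r s|) T * ν.m.real univ := by
  have hz : ∀ s ≤ 0, prim (fun s => |r s|) s = 0 := fun s hs =>
    prim_eq_zero_of_nonpos (fun s hs => by rw [h.neg s hs, abs_zero]) hs
  have h1 : prim (fun s => |ν.delay r s|) T ≤ prim (ν.abs.delay fun s => |r s|) T :=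
    intervalIntegral.integral_mono hT ((ν.locBdd_delay h.locBdd).abs.intervalIntegrable _ _)
      ((ν.abs.locBdd_delay h.locBdd.abs).intervalIntegrable _ _)
      fun s => ν.abs_delay_le h.locBdd s
  have h2 : ν.abs.delay (prim fun s => |r s|) 0 = 0 := by
    have : (fun u : Icc (-τ) 0 => prim (fun s => |r s|) (0 + u)) = fun _ => 0 :=
      funext fun u => hz _ (by simpa using u.2.2)
    rw [delay, this, ν.abs.int_const, zero_mul]
  rw [ν.abs.prim_delay h.locBdd.abs, h2, sub_zero] at h1
  refine h1.trans ((le_abs_self _).trans (ν.abs.abs_int_le fun u => ?_))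
  have hmono := fun {s t : ℝ} (hst : s ≤ t) =>
    prim_mono_of_nonneg h.locBdd.abs (fun s => abs_nonneg (r s)) hst
  rw [abs_of_nonneg]
  · exact hmono (by linarith [u.2.2])
  · exact (hz (min 0 (T + u)) (min_le_left _ _)).symm.le.trans (hmono (min_le_right _ _))

/-- The deviation of the resolvent from its mean is at most its variation, the integral of
`|ν.delay r|`, over the averaging interval. -/
lemma abs_sub_mean_le (hr : ν.IsRes r) {h t : ℝ} (hh : 0 < h) (ht : h ≤ t) :
    |r t - backwardMean r h t|
      ≤ prim (fun s => |ν.delay r s|) t - prim (fun s => |ν.delay r s|) (t - h) := by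
  have hρ := ν.locBdd_delay hr.locBdd
  set N := prim (fun s => |ν.delay r s|) with hN
  have hint : ∀ {s t}, s ≤ t → |prim (ν.delay r) t - prim (ν.delay r) s| ≤ N t - N s := by
    intro s t hst
    rw [hN, prim, prim, intervalIntegral.integral_interval_sub_left
      (hρ.intervalIntegrable _ _) (hρ.intervalIntegrable _ _), prim, prim,
      intervalIntegral.integral_interval_sub_left
      (hρ.abs.intervalIntegrable _ _) (hρ.abs.intervalIntegrable _ _)]
    exact intervalIntegral.abs_integral_le_integral_abs hst
  have h1 : r t - backwardMean r h t = h⁻¹ * ∫ s in (t - h)..t, (r t - r s) := by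
    rw [intervalIntegral.integral_sub (by simp) (hr.locBdd.intervalIntegrable _ _),
      backwardMean, prim, prim, intervalIntegral.integral_interval_sub_left
      (hr.locBdd.intervalIntegrable _ _) (hr.locBdd.intervalIntegrable _ _)]
    simp only [intervalIntegral.integral_const, sub_sub_cancel, smul_eq_mul]
    field_simp
  have h2 : ‖∫ s in (t - h)..t, (r t - r s)‖ ≤ (N t - N (t - h)) * |t - (t - h)| := by
    refine intervalIntegral.norm_integral_le_of_norm_le_const fun s hs => ?_
    rw [uIoc_of_le (by linarith)] at hs
    rw [Real.norm_eq_abs, hr.eq t (by linarith), hr.eq s (by linarith [hs.1]),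
      add_sub_add_left_eq_sub]
    refine (hint hs.2).trans (sub_le_sub_left ?_ _)
    exact prim_mono_of_nonneg hρ.abs (fun _ => abs_nonneg _) hs.1.le
  rw [sub_sub_cancel, abs_of_pos hh, Real.norm_eq_abs] at h2
  rw [h1, abs_mul, abs_of_pos (inv_pos.mpr hh), inv_mul_le_iff₀ hh]
  linarith

/-- If the means of the resolvent over short intervals are integrable, then so is the resolvent,
because the resolvent equation controls its oscillation on short intervals. -/
lemma integrableOn_of_mean (hr : ν.IsRes r) {h M : ℝ} (hh : 0 < h)
    (hm : h * ν.m.real univ ≤ 1 / 2)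
    (hM : ∀ T, 0 ≤ T → ∫ s in (0 : ℝ)..T, |backwardMean r h s| ≤ M) : IntegrableOn r (Ioi 0) := by
  have hρ := ν.locBdd_delay hr.locBdd
  set N := prim (fun s => |ν.delay r s|) with hN
  have hNL : LocBdd N := hρ.abs.prim
  have hNz : ∀ s ≤ 0, N s = 0 := fun s hs =>
    prim_eq_zero_of_nonpos (fun s hs => by rw [hr.delay_neg hs, abs_zero]) hs
  have hNm : ∀ {s t}, s ≤ t → N s ≤ N t := fun hst =>
    prim_mono_of_nonneg hρ.abs (fun _ => abs_nonneg _) hst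
  have hyc : Continuous (backwardMean r h) := by
    have := hr.locBdd.continuous_prim
    unfold backwardMean
    fun_prop
  have hyL := (LocBdd.of_continuous hyc).abs
  have hNs : LocBdd fun s => N (s - h) := hNL.comp_continuous (by fun_prop)
  have key : ∀ T, h ≤ T → prim (fun s => |r s|) T ≤ 2 * (prim (fun s => |r s|) h + M) := by
    intro T hT
    have hT0 : 0 ≤ T := hh.le.trans hT
    have hdL : LocBdd fun s => N s - N (s - h) := LocBdd.of_continuous (by
      have : Continuous N := hρ.abs.continuous_prim
      fun_prop)
    have h1 : ∫ s in h..T, |r s| ≤ ∫ s in h..T, (|backwardMean r h s| + (N s - N (s - h))) := by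
      refine intervalIntegral.integral_mono_on hT (hr.locBdd.abs.intervalIntegrable _ _)
        ((hyL.intervalIntegrable _ _).add (hdL.intervalIntegrable _ _)) fun s hs => ?_
      have := hr.abs_sub_mean_le hh hs.1
      have h3 := abs_sub_abs_le_abs_sub (r s) (backwardMean r h s)
      linarith
    have h2 : ∫ s in h..T, (|backwardMean r h s| + (N s - N (s - h)))
        ≤ ∫ s in (0 : ℝ)..T, (|backwardMean r h s| + (N s - N (s - h))) := by
      refine intervalIntegral.integral_mono_interval hh.le hT le_rfl
        (Eventually.of_forall fun s => ?_)
        ((hyL.intervalIntegrable _ _).add (hdL.intervalIntegrable _ _))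
      have := hNm (by linarith : s - h ≤ s)
      exact add_nonneg (abs_nonneg _) (by linarith)
    have h3 : ∫ s in (0 : ℝ)..T, (|backwardMean r h s| + (N s - N (s - h)))
        = (∫ s in (0 : ℝ)..T, |backwardMean r h s|) + (prim N T - prim (fun s => N (s - h)) T) := by
      rw [intervalIntegral.integral_add (hyL.intervalIntegrable _ _) (hdL.intervalIntegrable _ _)]
      congr 1
      exact prim_sub hNL hNs T
    -- `N` is monotone and vanishes on the negative half-line, so the integral telescopes.
    have h4 : prim N T - prim (fun s => N (s - h)) T ≤ N T * h := by
      have e1 := prim_comp_add hNL (-h) T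
      simp only [← sub_eq_add_neg] at e1
      have e2 : prim N (-h) = 0 := prim_eq_zero_of_nonpos (fun s hs => hNz s hs.le) (by linarith)
      rw [e1, e2, sub_zero, prim, prim, intervalIntegral.integral_interval_sub_left
        (hNL.intervalIntegrable _ _) (hNL.intervalIntegrable _ _)]
      have : ∫ s in (T - h)..T, N s ≤ ∫ s in (T - h)..T, N T :=
        intervalIntegral.integral_mono_on (by linarith) (hNL.intervalIntegrable _ _) (by simp)
          fun s hs => hNm hs.2
      refine this.trans (le_of_eq ?_)
      simp [mul_comm]
    have h5 := hr.prim_abs_delay_le hT0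
    have h6 : prim (fun s => |r s|) h + ∫ s in h..T, |r s| = prim (fun s => |r s|) T :=
      intervalIntegral.integral_add_adjacent_intervals (hr.locBdd.abs.intervalIntegrable _ _)
        (hr.locBdd.abs.intervalIntegrable _ _)
    have h7 : 0 ≤ prim (fun s => |r s|) T :=
      intervalIntegral.integral_nonneg hT0 fun _ _ => abs_nonneg _
    have h8 : N T * h ≤ prim (fun s => |r s|) T * (1 / 2) := by
      calc N T * h ≤ prim (fun s => |r s|) T * ν.m.real univ * h :=
            mul_le_mul_of_nonneg_right h5 hh.le
        _ = prim (fun s => |r s|) T * (h * ν.m.real univ) := by ring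
        _ ≤ _ := mul_le_mul_of_nonneg_left hm h7
    have := hM T hT0
    linarith
  refine integrableOn_Ioi_of_intervalIntegral_norm_bounded
    (2 * (prim (fun s => |r s|) h + M)) 0 (l := atTop) (b := id) (fun T => ?_) tendsto_id ?_
  · rcases le_total 0 T with hT | hT
    · exact (intervalIntegrable_iff_integrableOn_Ioc_of_le hT).mp
        (hr.locBdd.intervalIntegrable 0 T)
    · simp [Ioc_eq_empty_of_le hT]
  · filter_upwards [eventually_ge_atTop h] with T hT
    exact key T hT

/-- The variation of constants formula yields a solution with zero initial function for every
continuous forcing that vanishes on the negative half-line. -/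
lemma conv_eq (h : ν.IsRes r) {f : ℝ → ℝ} (hf : Continuous f) (hf0 : ∀ s, s ≤ 0 → f s = 0) :
    (∀ t, t ≤ 0 → conv r f t = 0) ∧ Continuous (conv r f) ∧
      ∀ t, conv r f t = prim (fun s => ν.delay (conv r f) s + f s) t := by
  have hfL := LocBdd.of_continuous hf
  have hneg : ∀ t, t ≤ 0 → conv r f t = 0 := fun t ht => by
    rw [conv, intervalIntegral.integral_congr_ae (g := fun _ => 0)]
    · simp
    · refine Eventually.of_forall fun s hs => ?_
      rw [uIoc_of_ge ht] at hs
      simp [hf0 s hs.2]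
  have hc := continuous_conv h.locBdd hf hf0
  have hcL := LocBdd.of_continuous hc
  refine ⟨hneg, hc, fun t => ?_⟩
  rcases le_total t 0 with ht | ht
  · rw [hneg t ht, prim_eq_zero_of_nonpos _ ht]
    intro s hs
    have : (fun u : Icc (-τ) 0 => conv r f (s + u)) = fun _ => 0 :=
      funext fun u => hneg _ (by linarith [u.2.2])
    rw [hf0 s hs.le, delay, this, ν.int_const, zero_mul, add_zero]
  · have hρ := ν.locBdd_delay h.locBdd
    have h1 : conv (ν.delay r) f = ν.delay (conv r f) := by
      funext w
      rw [ν.conv_delay_left h.locBdd hfL, delay]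
      congr 1
      funext u
      rw [← conv_causal h.locBdd hfL h.neg (by linarith [u.2.2] : w + (u : ℝ) ≤ w)]
      congr 1
      funext s
      congr 2
      ring
    have h2 : conv r f t = prim f t + conv (prim (ν.delay r)) f t := by
      have hpi : IntervalIntegrable (fun s => prim (ν.delay r) (t - s) * f s) volume 0 t :=
        ((hρ.prim.comp_continuous (by fun_prop)).mul hfL).intervalIntegrable _ _
      simp only [prim, conv] at hpi ⊢
      rw [← intervalIntegral.integral_add (hfL.intervalIntegrable 0 t) hpi]
      refine intervalIntegral.integral_congr_ae (Eventually.of_forall fun s hs => ?_)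
      rw [uIoc_of_le ht] at hs
      have := h.eq (t - s) (by linarith [hs.2])
      simp only [prim] at this
      simp only [this]
      ring
    rw [h2, ← prim_conv_left hρ hfL ht, h1, add_comm]
    exact (intervalIntegral.integral_add ((ν.locBdd_delay hcL).intervalIntegrable 0 t)
      (hfL.intervalIntegrable 0 t)).symm

lemma isSolution_conv (h : ν.IsRes r) (hν : ν.Represents μ) {f : ℝ → ℝ} (hf : Continuous f)
    (hf0 : ∀ s, s ≤ 0 → f s = 0) : IsSolution μ f 0 (conv r f) := by
  obtain ⟨h1, h2, h3⟩ := h.conv_eq hf hf0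
  have hgc : Continuous fun s => ν.delay (conv r f) s + f s :=
    (ν.continuous_delay h2).add hf
  refine ⟨⟨fun T hT => ?_, Eventually.of_forall fun t ht => ?_⟩, fun s => h1 s s.2.2⟩
  · have := (hgc.intervalIntegrable (μ := volume) 0 T).absolutelyContinuousOnInterval_intervalIntegral
      (c := 0) (by simp)
    rw [funext h3]
    exact this
  · rw [hν.integral_eq_delay (LocBdd.of_continuous h2) (fun _ _ => rfl) ht.le]
    have := intervalIntegral.integral_hasDerivAt_right (hgc.intervalIntegrable 0 t)
      (hgc.stronglyMeasurableAtFilter _ _) hgc.continuousAt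
    refine this.congr_of_eventuallyEq (Eventually.of_forall fun s => h3 s)

/-- If every forcing with a Cesàro limit gives a solution with a Cesàro limit, then the resolvent is
integrable.  The test forcings are difference quotients of functions `s⁺ g(s)` with `g` vanishing at
infinity; they have Cesàro limit zero although they need not be bounded. -/
lemma integrableOn_of_forall (hr : ν.IsRes r) (hν : ν.Represents μ)
    (H : ∀ (ψ : C(Icc (-τ) 0, ℝ)) (f x : ℝ → ℝ), f ∈ Ces → IsSolution μ f ψ x → x ∈ Ces) :
    IntegrableOn r (Ioi 0) := by
  -- With this `h` the oscillation of `r` costs at most half of its `L¹` norm.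
  set h : ℝ := 1 / (2 * (ν.m.real univ + 1)) with hh
  have hm0 : 0 ≤ ν.m.real univ := measureReal_nonneg
  have hh0 : 0 < h := by positivity
  have hhm : h * ν.m.real univ ≤ 1 / 2 := by
    rw [hh, div_mul_eq_mul_div, one_mul, div_le_div_iff₀ (by positivity) (by norm_num)]
    linarith
  have hRc := hr.locBdd.continuous_prim
  have hyc : Continuous (backwardMean r h) := by
    unfold backwardMean
    fun_prop
  have hy0 : ∀ s, s ≤ 0 → backwardMean r h s = 0 := fun s hs => by
    rw [backwardMean, hr.prim_nonpos hs, hr.prim_nonpos (by linarith), sub_zero, mul_zero]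
  obtain ⟨M, hM⟩ := exists_integral_abs_bound hyc hy0 fun g => by
    set K : ℝ → ℝ := fun s => max s 0 * g s with hK
    have hKc : Continuous K := by
      have := g.continuous
      fun_prop
    have hKL := LocBdd.of_continuous hKc
    have hK0 : ∀ s, s ≤ 0 → K s = 0 := fun s hs => by simp [hK, max_eq_right hs]
    have hKs : LocBdd fun s => K (s - h) := hKL.comp_continuous (by fun_prop)
    set f : ℝ → ℝ := fun s => h⁻¹ * (K s - K (s - h)) with hf
    have hfc : Continuous f := by fun_prop
    have hf0 : ∀ s, s ≤ 0 → f s = 0 := fun s hs => by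
      rw [hf]
      simp only
      rw [hK0 s hs, hK0 (s - h) (by linarith), sub_zero, mul_zero]
    have hKt : Tendsto (fun t => K t / t) atTop (𝓝 0) := by
      have : Tendsto g atTop (𝓝 0) :=
        (zero_at_infty g).mono_left atTop_le_cocompact
      refine this.congr' ?_
      filter_upwards [eventually_gt_atTop 0] with t ht
      rw [hK]
      simp only
      rw [max_eq_left ht.le]
      field_simp
    have hfCes : f ∈ Ces := by
      refine ⟨(LocBdd.of_continuous hfc).mem_L1loc, 0, hasCesaroLimit_iff.mpr ?_⟩
      have h1 := (tendsto_shift_div (Y := fun t => prim K (t + h) - prim K t)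
        (tendsto_prim_increment_div hKL hKt hh0.le) (-h)).const_mul h⁻¹
      rw [zero_mul, mul_zero] at h1
      refine h1.congr fun t => ?_
      have e1 := prim_comp_add hKL (-h) t
      have e2 : prim K (-h) = 0 :=
        prim_eq_zero_of_nonpos (fun s hs => hK0 s hs.le) (by linarith)
      simp only [← sub_eq_add_neg] at e1
      rw [hf, prim_const_mul, prim_sub hKL hKs, e1, e2, neg_add_cancel_right, ← sub_eq_add_neg]
      ring
    have hx := H 0 f (conv r f) hfCes (hr.isSolution_conv hν hfc hf0)
    obtain ⟨-, l, hl⟩ := hx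
    rw [hasCesaroLimit_iff] at hl
    have hconv : ∀ t, 0 ≤ t → prim (conv r f) t = conv (backwardMean r h) K t := fun t ht => by
      have hR := hr.locBdd.prim
      have hi : ∀ {a b : ℝ → ℝ}, LocBdd a → LocBdd b → ∀ c : ℝ,
          IntervalIntegrable (fun s => a (c - s) * b s) volume 0 t := fun ha hb c =>
        ((ha.comp_continuous (by fun_prop)).mul hb).intervalIntegrable _ _
      -- Both factors vanish on the negative half-line, so the shift can be moved between them.
      have e1 : conv (prim r) (fun s => K (s - h)) t = conv (prim r) K (t - h) := by
        rw [conv_comm, conv_comm (prim r) K,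
          ← conv_causal hKL hR (fun s hs => hK0 s hs.le) (by linarith : t - h ≤ t)]
        simp only [conv, sub_right_comm t h]
      have e2 := conv_causal hR hKL (fun s hs => hr.prim_nonpos hs.le) (by linarith : t - h ≤ t)
      have e3 : conv (backwardMean r h) K t
          = h⁻¹ * (conv (prim r) K t - ∫ s in (0 : ℝ)..t, prim r (t - h - s) * K s) := by
        rw [conv, conv, ← intervalIntegral.integral_sub (hi hR hKL t) (hi hR hKL (t - h)),
          ← intervalIntegral.integral_const_mul]
        congr 1
        funext s
        rw [backwardMean, sub_right_comm t h s]
        ring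
      have e4 : conv (prim r) f t
          = h⁻¹ * (conv (prim r) K t - conv (prim r) (fun s => K (s - h)) t) := by
        rw [conv, conv, conv, ← intervalIntegral.integral_sub (hi hR hKL t) (hi hR hKs t),
          ← intervalIntegral.integral_const_mul]
        congr 1
        funext s
        simp only [hf]
        ring
      rw [prim_conv_left hr.locBdd (LocBdd.of_continuous hfc) ht, e3, e4, e1, e2]
    have h2 := (hl.comp tendsto_natCast_atTop_atTop).abs
    obtain ⟨C, hC⟩ := h2.bddAbove_range
    refine ⟨C, fun n => ?_⟩
    rw [← hconv n (Nat.cast_nonneg n)]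
    exact hC ⟨n, rfl⟩
  exact hr.integrableOn_of_mean hh0 hhm hM

end PolarMeasure.IsRes

end

/-! ### Cesàro limits of forcings and solutions -/

section

variable {τ : ℝ} {μ : SignedMeasure (Icc (-τ) 0)} {ν : PolarMeasure τ} {f x y : ℝ → ℝ}

lemma ae_of_forall_pos {g h : ℝ → ℝ} (hgh : ∀ t, 0 < t → g t = h t) :
    ∀ᵐ t : ℝ, 0 < t → g t = h t :=
  Eventually.of_forall hgh

lemma PolarMeasure.IsSol.intervalAvg_mem_L1loc (h : ν.IsSol f y) (θ : ℝ) :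
    intervalAvg f θ ∈ L1loc := by
  rw [funext (h.intervalAvg_eq θ)]
  have := continuous_prim h.int
  exact (LocBdd.of_continuous (by fun_prop)).mem_L1loc

/-- Interval averages of a function with a Cesàro limit have Cesàro limits. -/
lemma intervalAvg_mem_Ces (hf : f ∈ Ces) {θ : ℝ} (hθ : 0 ≤ θ) : intervalAvg f θ ∈ Ces := by
  obtain ⟨hf1, L, hL⟩ := hf
  set f' := (Ici (0 : ℝ)).indicator f with hf'
  have hint := intervalIntegrable_indicator hf1
  have hc := continuous_prim hint
  have hcL := LocBdd.of_continuous hc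
  have heq : ∀ t, 0 < t → intervalAvg f θ t = prim f' (t + θ) - prim f' t := fun t ht => by
    rw [intervalAvg_indicator f hθ ht, intervalAvg, prim, prim,
      intervalIntegral.integral_interval_sub_left (hint _ _) (hint _ _)]
  rw [mem_Ces_congr (ae_of_forall_pos heq)]
  refine ⟨(LocBdd.of_continuous (by fun_prop)).mem_L1loc, L * θ, hasCesaroLimit_iff.mpr ?_⟩
  have hL' : Tendsto (fun t => prim f' t / t) atTop (𝓝 L) := by
    refine (hasCesaroLimit_iff.mp hL).congr' ?_
    filter_upwards [eventually_ge_atTop 0] with t ht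
    rw [hf', prim_indicator f ht]
  have := (tendsto_prim_increment_div hcL hL' hθ).sub
    (tendsto_const_div_atTop (prim (prim f') θ))
  rw [sub_zero] at this
  refine this.congr fun t => ?_
  rw [prim_increment hcL]
  ring

/-- The Cesàro means of `f`, `x`, `x'` and of the interval averages of `f`, expressed through a
forcing `f'` and a solution `y` that are defined and well-behaved on all of `ℝ`. -/
lemma IsSolution.exists_cesaro_data {ψ : C(Icc (-τ) 0, ℝ)} (hτ : 0 < τ)
    (hx : IsSolution μ f ψ x) (hν : ν.Represents μ) (hf : f ∈ L1loc) :
    ∃ f' y, ν.IsSol f' y ∧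
      (∀ L, HasCesaroLimit f L ↔ Tendsto (fun t => prim f' t / t) atTop (𝓝 L)) ∧
      (∀ l, HasCesaroLimit x l ↔ Tendsto (fun t => prim y t / t) atTop (𝓝 l)) ∧
      (∀ l, HasCesaroLimit (deriv x) l ↔ Tendsto (fun t => y t / t) atTop (𝓝 l)) ∧
      (∀ θ L, 0 ≤ θ → (HasCesaroLimit (intervalAvg f θ) L ↔
        Tendsto (fun t => prim (intervalAvg f' θ) t / t) atTop (𝓝 L))) ∧
      (∀ θ, 0 ≤ θ → intervalAvg f θ ∈ L1loc) ∧ x ∈ L1loc := by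
  obtain ⟨y, hy, hxy⟩ := hx.exists_isSol hτ hν hf
  have hxy' : ∀ᵐ t : ℝ, 0 < t → x t = y t :=
    ae_of_forall_pos fun t ht => (hxy t (by linarith)).symm
  have havg : ∀ {θ}, 0 ≤ θ → ∀ᵐ t : ℝ, 0 < t →
      intervalAvg f θ t = intervalAvg ((Ici (0 : ℝ)).indicator f) θ t := fun hθ =>
    ae_of_forall_pos fun t ht => intervalAvg_indicator f hθ ht
  refine ⟨_, y, hy, fun L => ?_, fun l => ?_, fun l => ?_, fun θ L hθ => ?_, fun θ hθ => ?_, ?_⟩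
  · rw [hasCesaroLimit_congr (ae_of_forall_pos fun t ht =>
      (indicator_of_mem (mem_Ici.mpr ht.le) f).symm), hasCesaroLimit_iff]
  · rw [hasCesaroLimit_congr hxy', hasCesaroLimit_iff]
  · rw [hasCesaroLimit_iff]
    have h1 : (fun t => prim (deriv x) t / t) =ᶠ[atTop] fun t => y t / t - x 0 / t := by
      filter_upwards [eventually_ge_atTop 0] with t ht
      rw [hx.1.prim_deriv ht, hxy t (by linarith), sub_div]
    rw [tendsto_congr' h1]
    have h2 := tendsto_const_div_atTop (x 0)
    exact ⟨fun h => by simpa using h.add h2, fun h => by simpa using h.sub h2⟩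
  · rw [hasCesaroLimit_congr (havg hθ), hasCesaroLimit_iff]
  · exact (mem_L1loc_congr (havg hθ)).mpr (hy.intervalAvg_mem_L1loc θ)
  · exact (mem_L1loc_congr hxy').mpr hy.locBdd.mem_L1loc

variable {r : ℝ → ℝ}

/-- The characterisation of Cesàro convergence of the solution by interval averages. -/
lemma cesaro_iff_intervalAvg (hτ : 0 < τ) (hν : ν.Represents μ) (hr : ν.IsRes r)
    (hi : IntegrableOn r (Ioi 0)) {ψ : C(Icc (-τ) 0, ℝ)} (hf : f ∈ L1loc)
    (hx : IsSolution μ f ψ x) :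
    ((∀ θ ∈ Ioc (0 : ℝ) 1, intervalAvg f θ ∈ Ces) ↔ x ∈ Ces) ∧
      (x ∈ Ces → ∃ L : ℝ,
        (∀ θ ∈ Ioc (0 : ℝ) 1, HasCesaroLimit (intervalAvg f θ) (L * θ)) ∧
        HasCesaroLimit x (-L / ν.mass)) := by
  obtain ⟨f', y, hy, -, hxl, -, hal, ha1, hx1⟩ := hx.exists_cesaro_data hτ hν hf
  have hm0 : ν.mass ≠ 0 := fun h0 => by simpa [h0] using hr.integral_mul_mass hi
  have hfwd : ∀ l, HasCesaroLimit x l → ∀ θ ∈ Ioc (0 : ℝ) 1,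
      HasCesaroLimit (intervalAvg f θ) (-(l * ν.mass) * θ) := fun l hl θ hθ =>
    (hal θ _ hθ.1.le).mpr (hy.tendsto_prim_intervalAvg_div ((hxl l).mp hl) hθ.1.le)
  refine ⟨⟨fun h => ⟨hx1, ?_⟩, fun ⟨_, l, hl⟩ θ hθ => ⟨ha1 θ hθ.1.le, _, hfwd l hl θ hθ⟩⟩,
    fun ⟨_, l, hl⟩ => ⟨-(l * ν.mass), hfwd l hl, ?_⟩⟩
  · obtain ⟨l, hl⟩ := hy.exists_tendsto_prim_div hr hi fun θ hθ =>
      (h θ hθ).2.imp fun L hL => (hal θ L hθ.1.le).mp hL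
    exact ⟨l, (hxl l).mpr hl⟩
  · rwa [neg_neg, mul_div_cancel_right₀ _ hm0]

/-- The characterisation of Cesàro convergence of the forcing by the solution and its
derivative. -/
lemma cesaro_iff_deriv (hτ : 0 < τ) (hν : ν.Represents μ) (hr : ν.IsRes r)
    (hi : IntegrableOn r (Ioi 0)) {ψ : C(Icc (-τ) 0, ℝ)} (hf : f ∈ L1loc)
    (hx : IsSolution μ f ψ x) :
    (f ∈ Ces ↔ x ∈ Ces ∧ deriv x ∈ Ces) ∧
      (f ∈ Ces → ∃ L : ℝ, HasCesaroLimit f L ∧ HasCesaroLimit x (-L / ν.mass) ∧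
        HasCesaroLimit (deriv x) 0) := by
  obtain ⟨f', y, hy, hfl, hxl, hdl, -, -, hx1⟩ := hx.exists_cesaro_data hτ hν hf
  have hm0 : ν.mass ≠ 0 := fun h0 => by simpa [h0] using hr.integral_mul_mass hi
  have hfwd : ∀ L, HasCesaroLimit f L →
      HasCesaroLimit x (-L / ν.mass) ∧ HasCesaroLimit (deriv x) 0 := fun L hL => by
    have h1 := (hfl L).mp hL
    have h2 := hy.tendsto_prim_div hr hi h1
    refine ⟨(hxl _).mpr h2, (hdl 0).mpr ?_⟩
    have h3 := (hy.tendsto_div_sub h2).add h1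
    rw [div_mul_cancel₀ _ hm0, neg_add_cancel] at h3
    exact h3.congr fun t => by ring
  refine ⟨⟨fun ⟨_, L, hL⟩ => ⟨⟨hx1, _, (hfwd L hL).1⟩, hx.1.deriv_mem_L1loc, _, (hfwd L hL).2⟩,
    fun ⟨⟨_, l, hl⟩, _, l', hl'⟩ => ⟨hf, l' - l * ν.mass, (hfl _).mpr ?_⟩⟩,
    fun ⟨_, L, hL⟩ => ⟨L, hL, hfwd L hL⟩⟩
  refine (((hdl l').mp hl').sub (hy.tendsto_div_sub ((hxl l).mp hl))).congr fun t => ?_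
  ring

end

end DelayCesaro

end

open DelayCesaro
theorem mainTheorem2 (τ : ℝ) (hτ : 0 < τ) (μ : SignedMeasure (Icc (-τ) 0))
    (r : ℝ → ℝ) (hr : IsResolvent μ r) :
    -- (A)
    (IntegrableOn r (Ici 0) →
      μ univ ≠ 0 ∧
      ∀ (ψ : C(Icc (-τ) 0, ℝ)) (f x : ℝ → ℝ), f ∈ L1loc → IsSolution μ f ψ x →
        -- (i), with the limits
        (((∀ θ ∈ Ioc (0 : ℝ) 1, intervalAvg f θ ∈ Ces) ↔ x ∈ Ces) ∧
          (x ∈ Ces → ∃ L : ℝ,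
            (∀ θ ∈ Ioc (0 : ℝ) 1, HasCesaroLimit (intervalAvg f θ) (L * θ)) ∧
            HasCesaroLimit x (-L / μ univ))) ∧
        -- (ii), with the limits
        ((f ∈ Ces ↔ x ∈ Ces ∧ deriv x ∈ Ces) ∧
          (f ∈ Ces → ∃ L : ℝ,
            HasCesaroLimit f L ∧
            HasCesaroLimit x (-L / μ univ) ∧
            HasCesaroLimit (deriv x) 0))) ∧
    -- (B)
    List.TFAE [
      IntegrableOn r (Ici 0),
      ∀ (ψ : C(Icc (-τ) 0, ℝ)) (f x : ℝ → ℝ), f ∈ Ces → IsSolution μ f ψ x → x ∈ Ces,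
      ∀ (ψ : C(Icc (-τ) 0, ℝ)) (f x : ℝ → ℝ), f ∈ L1loc →
        (∀ θ ∈ Ioc (0 : ℝ) 1, intervalAvg f θ ∈ Ces) → IsSolution μ f ψ x → x ∈ Ces] := by
  obtain ⟨ν, hmass, hrep⟩ := PolarMeasure.exists_represents μ
  have hres : ν.IsRes r := hr.isRes hrep
  rw [hmass, integrableOn_Ici_iff_integrableOn_Ioi]
  refine ⟨fun hi => ⟨fun h0 => by simpa [h0] using hres.integral_mul_mass hi,
    fun ψ f x hf hx => ⟨cesaro_iff_intervalAvg hτ hrep hres hi hf hx,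
      cesaro_iff_deriv hτ hrep hres hi hf hx⟩⟩, ?_⟩
  tfae_have 1 → 3 := fun hi ψ f x hf havg hx =>
    (cesaro_iff_intervalAvg hτ hrep hres hi hf hx).1.mp havg
  tfae_have 3 → 2 := fun h ψ f x hf hx =>
    h ψ f x hf.1 (fun θ hθ => intervalAvg_mem_Ces hf hθ.1.le) hx
  tfae_have 2 → 1 := fun h => hres.integrableOn_of_forall hrep h
  tfae_finish
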